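/- Let $k$ be the $(p,q)$ torus knot ($p,q\ge 1$ coprime) or its mirror image, and let $\pi=\pi_1(\mathbb S^3\setminus k)$, given by the Wirtinger presentation of the standard diagram of $k$ as the closure of the braid $(\sigma_1\cdots\sigma_{p-1})^q$ on $p$ strands (or of the mirror image of that diagram). Let $\epsilon:\pi\to\mathbb Z$ be the abelianization sending every Wirtinger generator to $1$. *Twisted Alexander polynomials.* For a representation $\rho:\pi\to \mathrm{GL}_N R$ ($R=\mathbb Z$ or $\mathbb C$), let $\pi$ act from the right on the row vectors $R[t^{\pm1}]\otimes V$, $V=R^N$, by $(f\otimes v)\cdot g=ft^{\epsilon(g)}\otimes v\rho(g)$. Let $H_1(X';V)$ be the resulting twisted first homology of the exterior of $k$, computed from the 2-complex of the Wirtinger presentation: it is $\ker\partial_1/\operatorname{im}\partial_2$ with $\partial_1(v\otimes x)=v\cdot x-v$ for a generator $x$, and $\partial_2(v\otimes r)=v\otimes x_i+(v\cdot x_i)\otimes x_j-v\otimes x_k-(v\cdot x_k)\otimes x_i$ for a relator $r=x_ix_jx_i^{-1}x_k^{-1}$. The $\rho$-twisted Alexander polynomial $\Delta_{k,\rho}(t)\in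 R[t^{\pm1}]$ is the order of this module, i.e. the greatest common divisor of the $b\times b$ minors of a presentation matrix with $b$ generators; it is well defined up to a unit of $R[t^{\pm1}]$. *Parabolic and total representations.* A representation $\gamma:\pi\to\mathrm{SL}_2\mathbb C$ is *parabolic* if the image of every meridian has trace $2$. Suppose that $\gamma$ is conjugate over $\mathbb C$ to a representation $\gamma'$ with image in $\mathrm{SL}_2(A)$, where $A\subset\mathbb C$ is a subring that is free of finite rank $m$ as a $\mathbb Z$-module. A *total representation* $\gamma_\phi:\pi\to\mathrm{GL}_{2m}\mathbb Z$ of $\gamma$ is obtained from $\gamma'$ by replacing each matrix entry $w\in A$ by the integer $m\times m$ block of multiplication by $w$ with respect to a $\mathbb Z$-basis of $A$. (For $A=\mathbb Z[w]$ with basis $1,w,\dots,w^{m-1}$, the block of $w$ is the companion matrix of its minimal polynomial $\phi$.) The polynomial $\Delta_{k,\gamma_\phi}(t)\in\mathbb Z[t^{\pm1}]$ is called a *total twisted Alexander polynomial*. **Theorem.** Let $\gamma:\pi\to\mathrm{SL}_2\mathbb C$ be any parabolic representation of the group of $k$. Then: 1. $\gamma$ has a total representation: there are $A$ and $\gamma'$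 as above. 2. For every total representation $\gamma_\phi$ of $\gamma$ (every choice of $A$, $\gamma'$ and basis), the total twisted Alexander polynomial $\Delta_{k,\gamma_\phi}(t)$ exists and, up to a unit $\pm t^i$, is a (possibly empty) product of cyclotomic polynomials. 3. The $\gamma$-twisted Alexander polynomial $\Delta_{k,\gamma}(t)\in\mathbb C[t^{\pm1}]$ exists and, up to a unit $ct^i$ with $c\in\mathbb C^*$, is a product of factors $t-\zeta$ with $\zeta$ a root of unity; that is, it is nonzero and all its zeros are roots of unity. -/

import Mathlib

open scoped LaurentPolynomial MatrixGroups

noncomputable section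

/-- The combinatorial data of a Wirtinger presentation: `ι` indexes the generators (arcs of an
oriented diagram) and `κ` the relations.  At `c : κ` the arc `inArc c` passes under the arc `overArc c`
and emerges as the arc `outArc c`, which gives the relation
`x_over * x_inc * x_over⁻¹ = x_out`. -/
structure WirtingerData (ι κ : Type) where
  overArc : κ → ι
  inArc : κ → ι
  outArc : κ → ι

/-- The homology `ker d₁ / im d₂` of a complex `M₂ → M₁ → M₀`. -/
abbrev MiddleHomology {S : Type} [CommRing S] {M₂ M₁ M₀ : Type}
    [AddCommGroup M₂] [AddCommGroup M₁] [AddCommGroup M₀] [Module S M₂] [Module S M₁] [Module S M₀]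
    (d₂ : M₂ →ₗ[S] M₁) (d₁ : M₁ →ₗ[S] M₀) : Type :=
  LinearMap.ker d₁ ⧸ (LinearMap.range d₂).submoduleOf (LinearMap.ker d₁)

namespace WirtingerData

variable {ι κ : Type} (W : WirtingerData ι κ)

/-- The Wirtinger relator `x_over * x_inc * x_over⁻¹ * x_out⁻¹`. -/
def relator (c : κ) : FreeGroup ι :=
  FreeGroup.of (W.overArc c) * FreeGroup.of (W.inArc c) *
    (FreeGroup.of (W.overArc c))⁻¹ * (FreeGroup.of (W.outArc c))⁻¹

/-- The group `π` of the Wirtinger presentation. -/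
abbrev KnotGroup : Type := PresentedGroup (Set.range W.relator)

/-- The Wirtinger generator `x_i` of `π`. -/
def gen (i : ι) : W.KnotGroup := PresentedGroup.of i

/-- The meridians: the conjugates of the Wirtinger generators. -/
def IsMeridian (g : W.KnotGroup) : Prop :=
  ∃ (i : ι) (h : W.KnotGroup), g = h * W.gen i * h⁻¹

/-- The abelianization homomorphism `ε`, sending each Wirtinger generator to `1 ∈ ℤ`. -/
def epsilon : W.KnotGroup →* Multiplicative ℤ :=
  PresentedGroup.toGroup (f := fun _ : ι => Multiplicative.ofAdd (1 : ℤ)) (by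
    rintro r ⟨c, rfl⟩
    simp [relator])

/-- The mirror image (reflection of the picture of the diagram in a line): the over-arc at each
crossing is kept and the sign of each crossing is reversed. -/
def mirror : WirtingerData ι κ where
  overArc := W.overArc
  inArc := W.outArc
  outArc := W.inArc

/-- A representation in `SL₂(ℂ)` is parabolic if the image of every meridian has trace `2`. -/
def IsParabolic (γ : W.KnotGroup →* SL(2, ℂ)) : Prop :=
  ∀ g, W.IsMeridian g → Matrix.trace (γ g : Matrix (Fin 2) (Fin 2) ℂ) = 2

section Homology

variable {R : Type} [CommRing R] {n : Type} [Fintype n] [DecidableEq n]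
  (γ : W.KnotGroup →* Matrix.GeneralLinearGroup n R)

/-- The matrix `t ^ ε(g) γ(g)` by which `g ∈ π` acts from the right on the row vectors
`R[t, t⁻¹] ⊗ V`, where `V = R^n`. -/
def twist (g : W.KnotGroup) : Matrix n n R[T;T⁻¹] :=
  (LaurentPolynomial.T (Multiplicative.toAdd (W.epsilon g)) : R[T;T⁻¹]) •
    (LaurentPolynomial.C (R := R)).mapMatrix (γ g : Matrix n n R)

/-- The boundary `∂₁ : C₁(X'; V) → C₀(X'; V)`, `v ⊗ x_i ↦ v · x_i - v`. -/
def boundary₁ : (ι →₀ (n → R[T;T⁻¹])) →ₗ[R[T;T⁻¹]] (n → R[T;T⁻¹]) :=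
  Finsupp.lsum R[T;T⁻¹] fun i =>
    Matrix.vecMulLinear (W.twist γ (W.gen i)) - LinearMap.id

/-- The boundary `∂₂ : C₂(X'; V) → C₁(X'; V)`: for the relator `r = x_i x_j x_i⁻¹ x_k⁻¹`,
`v ⊗ r ↦ v ⊗ x_i + (v · x_i) ⊗ x_j - v ⊗ x_k - (v · x_k) ⊗ x_i`. -/
def boundary₂ : (κ →₀ (n → R[T;T⁻¹])) →ₗ[R[T;T⁻¹]] (ι →₀ (n → R[T;T⁻¹])) :=
  Finsupp.lsum R[T;T⁻¹] fun c =>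
    Finsupp.lsingle (W.overArc c)
      + Finsupp.lsingle (W.inArc c) ∘ₗ Matrix.vecMulLinear (W.twist γ (W.gen (W.overArc c)))
      - Finsupp.lsingle (W.outArc c)
      - Finsupp.lsingle (W.overArc c) ∘ₗ Matrix.vecMulLinear (W.twist γ (W.gen (W.outArc c)))

theorem twist_mul (g h : W.KnotGroup) : W.twist γ (g * h) = W.twist γ g * W.twist γ h := by
  simp only [twist, map_mul, toAdd_mul, LaurentPolynomial.T_add, Units.val_mul,
    Matrix.smul_mul, Matrix.mul_smul, smul_smul]
  rw [mul_comm]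

theorem gen_relation (c : κ) :
    W.gen (W.overArc c) * W.gen (W.inArc c) = W.gen (W.outArc c) * W.gen (W.overArc c) := by
  have h : (PresentedGroup.mk (Set.range W.relator)) (W.relator c) = 1 :=
    PresentedGroup.one_of_mem ⟨c, rfl⟩
  simp only [relator, map_mul, map_inv] at h
  exact mul_inv_eq_iff_eq_mul.mp (mul_inv_eq_one.mp h)

/-- The boundaries form a chain complex. -/
theorem boundary₁_comp_boundary₂ : W.boundary₁ γ ∘ₗ W.boundary₂ γ = 0 := by
  have key (c : κ) := congrArg (W.twist γ) (W.gen_relation c)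
  simp only [twist_mul] at key
  refine Finsupp.lhom_ext fun c v => ?_
  simp only [boundary₁, boundary₂, LinearMap.comp_apply, Finsupp.lsum_single, LinearMap.sub_apply,
    LinearMap.add_apply, Finsupp.lsingle_apply, map_add, map_sub, Matrix.vecMulLinear_apply,
    LinearMap.id_apply, LinearMap.zero_apply, Matrix.vecMul_vecMul, key c]
  abel

/-- The twisted homology module `H₁(X'; V) = ker ∂₁ / im ∂₂` over `R[t, t⁻¹]`. -/
abbrev TwistedH1 : Type :=
  MiddleHomology (W.boundary₂ γ) (W.boundary₁ γ)

end Homology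

end WirtingerData

/-- `Δ` is the order (zeroth elementary divisor) of the module `M`: for a presentation of `M` with
`b` generators and `a` relations, the rows of `P`, it is a greatest common divisor of the
`b × b` minors of `P`.  (For a non-injective choice `f` of rows the determinant vanishes.) -/
def IsModuleOrder {S : Type} [CommRing S] (M : Type) [AddCommGroup M] [Module S M] (Δ : S) :
    Prop :=
  ∃ (a b : ℕ) (P : Matrix (Fin a) (Fin b) S),
    Nonempty (M ≃ₗ[S] (Fin b → S) ⧸ Submodule.span S (Set.range P.row)) ∧
    ∀ d : S, d ∣ Δ ↔ ∀ f : Fin b → Fin a, d ∣ (P.submatrix f id).det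

/-- `Δ ∈ R[t, t⁻¹]` is a `γ`-twisted Alexander polynomial, that is, an order of `H₁(X'; V)`;
it is determined up to a unit of `R[t, t⁻¹]`. -/
def WirtingerData.IsTwistedAlexanderPolynomial {ι κ : Type} (W : WirtingerData ι κ)
    {R : Type} [CommRing R] {n : Type} [Fintype n] [DecidableEq n]
    (γ : W.KnotGroup →* Matrix.GeneralLinearGroup n R) (Δ : R[T;T⁻¹]) : Prop :=
  IsModuleOrder (W.TwistedH1 γ) Δ

/-- The Wirtinger presentation of the standard diagram of the `(p, q)` torus knot, the closure of
the braid `(σ₁ ⋯ σ_{p-1}) ^ q`.  The generator `(k, i)` belongs to the `i`-th of the `p` strands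
on entering the `k`-th of the `q` factors `σ₁ ⋯ σ_{p-1}`.  In this factor strand `0` passes over
all the others and becomes strand `p - 1`, and for `i ≠ 0` strand `i` passes under it once and
becomes strand `i - 1`.  For `i = 0` the relation says `x_{(k+1, p-1)} = x_{(k, 0)}`:
the over-strand carries a single arc. -/
def torusKnot (p q : ℕ) : WirtingerData (ZMod q × ZMod p) (ZMod q × ZMod p) where
  overArc c := (c.1, 0)
  inArc c := c
  outArc c := (c.1 + 1, c.2 - 1)

/-- The representation over `A ⊆ ℂ` becomes `γ` after extension of scalars to `ℂ` and
conjugation. -/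
def IsConjugateOver {G : Type} [Group G] (γ : G →* SL(2, ℂ)) (A : Subalgebra ℤ ℂ)
    (γ' : G →* SL(2, A)) : Prop :=
  ∃ P : GL (Fin 2) ℂ, ∀ g : G,
    (γ g : Matrix (Fin 2) (Fin 2) ℂ) =
      (P : Matrix (Fin 2) (Fin 2) ℂ) * (γ' g : Matrix (Fin 2) (Fin 2) A).map A.val *
        ((P⁻¹ : GL (Fin 2) ℂ) : Matrix (Fin 2) (Fin 2) ℂ)

/-- The ring homomorphism `M₂(A) → M_{2m}(ℤ)` replacing each entry `w` by the integer `m × m`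
block of multiplication by `w` in the `ℤ`-basis `β` of `A`.  If `A = ℤ[w]` with basis
`1, w, …, w ^ (m - 1)`, the block of `w` is the companion matrix of its minimal polynomial. -/
def blockHom {A : Type} [CommRing A] {m : ℕ} (β : Module.Basis (Fin m) ℤ A) :
    Matrix (Fin 2) (Fin 2) A →+* Matrix (Fin 2 × Fin m) (Fin 2 × Fin m) ℤ :=
  (Matrix.compRingEquiv (Fin 2) (Fin m) ℤ).toRingHom.comp
    (Algebra.leftMulMatrix β).toRingHom.mapMatrix

/-- The total representation `π → GL_{2m}(ℤ)` of a representation `π → SL₂(A)`. -/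
def totalRepresentation {G : Type} [Group G] {A : Type} [CommRing A] {m : ℕ}
    (β : Module.Basis (Fin m) ℤ A) (γ' : G →* SL(2, A)) :
    G →* Matrix.GeneralLinearGroup (Fin 2 × Fin m) ℤ :=
  (Units.map (blockHom β : Matrix (Fin 2) (Fin 2) A →* _)).comp
    (Matrix.SpecialLinearGroup.toGL.comp γ')

/-- Up to a unit `± t ^ i`, `Δ` is a (possibly empty) product of cyclotomic polynomials. -/
def IsProductOfCyclotomics (Δ : ℤ[T;T⁻¹]) : Prop :=
  ∃ s : Multiset ℕ, (∀ n ∈ s, 0 < n) ∧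
    Associated Δ (Polynomial.toLaurent (s.map fun n => Polynomial.cyclotomic n ℤ).prod)

/-- Up to a unit `c t ^ i`, `Δ` is a (possibly empty) product of factors `t - ζ` with `ζ` a root
of unity; that is, `Δ` is nonzero and all its zeros are roots of unity. -/
def IsProductOfRootOfUnityFactors (Δ : ℂ[T;T⁻¹]) : Prop :=
  ∃ s : Multiset ℂ, (∀ ζ ∈ s, ∃ n : ℕ, 0 < n ∧ ζ ^ n = 1) ∧
    Associated Δ
      (Polynomial.toLaurent (s.map fun ζ => Polynomial.X - Polynomial.C ζ).prod)

end

/-! A torus knot group has a large centre, and the centre controls twisted homology. Let `P` and `Q`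
be the products of `p`, respectively `q`, consecutive over-arcs. They generate the group, and `P ^ q
= Q ^ p` is central (`exists_torus_generators`). For the mirror image the same relations hold for
the inverses of the Wirtinger generators.

Put `z = (P ^ q) ^ 2`. Its image under a parabolic `γ` is unipotent (`central_sub_one_mul_self`): if
`γ` has commutative image, that image is generated by one parabolic matrix; otherwise `γ (P ^ q)`
commutes with two non-commuting matrices, so it is `±1`. Now `z` acts on chains by `t ^ ε(z) γ(z)`,
and on `H₁` trivially because it is central. Together with `(γ(z) - 1)² = 0` this shows that `(t ^
ε(z) - 1)²` kills `H₁` (`smul_twistedH1_eq_zero`). The order of a module divides a power of any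
annihilating element (`IsModuleOrder.dvd_pow`), so the Alexander polynomial divides a power of `t ^
n - 1` with `n ≠ 0`, and unique factorization finishes. The identity `(γ(z) - 1)² = 0` passes to
every total representation, which gives the integral statement by the same argument.

For the existence of a total representation in the non-commutative case, choose `a p = b q + 1`.
Then `U = γ(P ^ a)` and `V = γ(Q ^ b)⁻¹` have finite order, and `U V` is the image of a meridian. In
Riley's normal form (`exists_riley_form`) the entries of `U` and `V` are roots of unity, `0`, `1`,
and one further entry, which trace `2` forces to be an algebraic integer. The entries therefore lie
in a subring of `ℂ` that is free of finite rank over `ℤ`. -/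

open scoped LaurentPolynomial MatrixGroups

/-! ### Divisors of powers of `t ^ n - 1` in Laurent polynomial rings -/

theorem Multiset.exists_le_associated_prod_of_dvd_prod {M : Type*} [CommMonoidWithZero M]
    [IsCancelMulZero M] (s : Multiset M) (hs : ∀ x ∈ s, Prime x) {d : M} (h : d ∣ s.prod) :
    ∃ u ≤ s, Associated d u.prod := by
  induction s using Multiset.induction generalizing d with
  | empty =>
    refine ⟨0, le_rfl, ?_⟩
    simpa [associated_one_iff_isUnit, isUnit_iff_dvd_one] using h
  | cons a s ih =>
    have ha : Prime a := hs a (Multiset.mem_cons_self a s)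
    have ih' := fun {d} => ih (d := d) fun x hx => hs x (Multiset.mem_cons_of_mem hx)
    rw [Multiset.prod_cons] at h
    rcases ha.left_dvd_or_dvd_right_of_dvd_mul h with ⟨e, rfl⟩ | hd
    · obtain ⟨u, hu, hue⟩ := ih' ((mul_dvd_mul_iff_left ha.ne_zero).mp h)
      refine ⟨a ::ₘ u, Multiset.cons_le_cons a hu, ?_⟩
      rw [Multiset.prod_cons]
      exact hue.mul_left a
    · obtain ⟨u, hu, hue⟩ := ih' hd
      exact ⟨u, hu.trans (Multiset.le_cons_self s a), hue⟩

theorem Multiset.exists_map_eq_of_forall_mem {α β : Type*} (F : α → β) (Q : α → Prop)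
    (u : Multiset β) (hu : ∀ x ∈ u, ∃ a, Q a ∧ F a = x) :
    ∃ s : Multiset α, (∀ a ∈ s, Q a) ∧ s.map F = u := by
  induction u using Multiset.induction with
  | empty => exact ⟨0, by simp, by simp⟩
  | cons x u ih =>
    obtain ⟨s, hs, rfl⟩ := ih fun y hy => hu y (Multiset.mem_cons_of_mem hy)
    obtain ⟨a, ha, rfl⟩ := hu x (Multiset.mem_cons_self x _)
    exact ⟨a ::ₘ s, by simpa [ha] using hs, by simp⟩

namespace LaurentPolynomial

theorem associated_mul_T {R : Type*} [CommRing R] (f : R[T;T⁻¹]) (n : ℤ) :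
    Associated f (f * T n) :=
  (associated_mul_isUnit_right_iff (isUnit_T n)).mpr (Associated.refl f)

/-- Up to units, a divisor of a product of primes of `R[X]` in `R[t, t⁻¹]` is the product of some
of them. -/
theorem exists_associated_toLaurent_prod {R : Type*} [CommRing R] [IsDomain R]
    (s : Multiset (Polynomial R)) (hs : ∀ f ∈ s, Prime f) {Δ : R[T;T⁻¹]}
    (h : Δ ∣ Polynomial.toLaurent s.prod) :
    ∃ u : Multiset (Polynomial R), (∀ f ∈ u, f ∈ s) ∧
      Associated Δ (Polynomial.toLaurent u.prod) := by
  classical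
  obtain ⟨c, hc⟩ := h
  obtain ⟨n, f, hf⟩ := exists_T_pow Δ
  obtain ⟨m, g, hg⟩ := exists_T_pow c
  -- Clearing denominators moves the divisibility to `R[X]` at the cost of extra factors `X`. These
  -- are prime too, and become units again in `R[t, t⁻¹]`.
  have hfg : f ∣ (s + Multiset.replicate (n + m) Polynomial.X).prod := by
    refine ⟨g, Polynomial.toLaurent_injective ?_⟩
    rw [Multiset.prod_add, Multiset.prod_replicate, map_mul, map_mul, hf, hg, hc,
      Polynomial.toLaurent_X_pow, Nat.cast_add, T_add]
    ring
  obtain ⟨u, hu, hfu⟩ := Multiset.exists_le_associated_prod_of_dvd_prod _ (by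
    intro x hx
    rcases Multiset.mem_add.mp hx with hx | hx
    · exact hs x hx
    · rw [Multiset.eq_of_mem_replicate hx]
      exact Polynomial.prime_X) hfg
  obtain ⟨k, -, hk⟩ := Multiset.le_replicate_iff.mp (tsub_le_iff_left.mpr hu)
  refine ⟨u ∩ s, fun f hf => (Multiset.mem_inter.mp hf).2, ?_⟩
  have h1 : Associated (Polynomial.toLaurent f) (Polynomial.toLaurent u.prod) := hfu.map _
  rw [← Multiset.sub_add_inter u s, Multiset.prod_add, hk, Multiset.prod_replicate, map_mul, mul_comm,
    Polynomial.toLaurent_X_pow, hf] at h1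
  exact (associated_mul_T Δ n).trans (h1.trans (associated_mul_T _ k).symm)

theorem associated_T_sub_one {R : Type*} [CommRing R] (n : ℤ) :
    Associated (T n - 1 : R[T;T⁻¹]) (Polynomial.toLaurent (Polynomial.X ^ n.natAbs - 1)) := by
  rw [map_sub, Polynomial.toLaurent_X_pow, map_one]
  rcases Int.natAbs_eq n with h | h
  · rw [← h]
  · have : (T (n.natAbs : ℤ) - 1 : R[T;T⁻¹]) = -((T n - 1) * T (n.natAbs : ℤ)) := by
      rw [sub_mul, ← T_add]
      nth_rw 2 [h]
      simp
    rw [this]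
    exact (associated_mul_T _ _).trans (Associated.refl _).neg_right

instance isNoetherianRing {R : Type*} [CommRing R] [IsNoetherianRing R] :
    IsNoetherianRing R[T;T⁻¹] :=
  IsLocalization.isNoetherianRing (Submonoid.powers (Polynomial.X : Polynomial R)) _ inferInstance

instance uniqueFactorizationMonoid {R : Type*} [CommRing R] [IsDomain R]
    [UniqueFactorizationMonoid R] : UniqueFactorizationMonoid R[T;T⁻¹] :=
  UniqueFactorizationMonoid.of_isLocalization
    (Submonoid.powers (Polynomial.X : Polynomial R)) _

end LaurentPolynomial

open LaurentPolynomial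

/-- Up to a unit `t ^ n - 1` is the product of the cyclotomic polynomials of the divisors of `|n|`,
and these are irreducible, hence prime, in `ℤ[X]`. -/
theorem isProductOfCyclotomics_of_dvd {Δ : ℤ[T;T⁻¹]} {n : ℤ} (hn : n ≠ 0) (k : ℕ)
    (h : Δ ∣ (T n - 1) ^ k) : IsProductOfCyclotomics Δ := by
  have h1 := ((associated_T_sub_one (R := ℤ) n).pow_pow (n := k)).dvd_iff_dvd_right.mp h
  rw [← map_pow, ← Polynomial.prod_cyclotomic_eq_X_pow_sub_one (Int.natAbs_pos.mpr hn),
    Finset.prod, ← Multiset.prod_nsmul] at h1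
  have hmem : ∀ f ∈ k • n.natAbs.divisors.val.map fun i => Polynomial.cyclotomic i ℤ,
      ∃ i, 0 < i ∧ Polynomial.cyclotomic i ℤ = f := by
    intro f hf
    obtain ⟨i, hi, rfl⟩ := Multiset.mem_map.mp (Multiset.mem_of_mem_nsmul hf)
    exact ⟨i, Nat.pos_of_mem_divisors hi, rfl⟩
  obtain ⟨u, hu, hΔ⟩ := exists_associated_toLaurent_prod _ (fun f hf => by
    obtain ⟨i, hi, rfl⟩ := hmem f hf
    exact (Polynomial.cyclotomic.irreducible hi).prime) h1
  obtain ⟨s, hs, rfl⟩ := Multiset.exists_map_eq_of_forall_mem (fun i => Polynomial.cyclotomic i ℤ)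
    (fun i => 0 < i) u fun f hf => hmem f (hu f hf)
  exact ⟨s, hs, hΔ⟩

theorem isProductOfRootOfUnityFactors_of_dvd {Δ : ℂ[T;T⁻¹]} {n : ℤ} (hn : n ≠ 0) (k : ℕ)
    (h : Δ ∣ (T n - 1) ^ k) : IsProductOfRootOfUnityFactors Δ := by
  have h1 := ((associated_T_sub_one (R := ℂ) n).pow_pow (n := k)).dvd_iff_dvd_right.mp h
  have hpos := Int.natAbs_pos.mpr hn
  rw [← map_pow, Polynomial.X_pow_sub_one_eq_prod hpos
    (Complex.isPrimitiveRoot_exp _ hpos.ne'), Finset.prod, ← Multiset.prod_nsmul] at h1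
  have hmem : ∀ f ∈ k • (Polynomial.nthRootsFinset n.natAbs (1 : ℂ)).val.map
      fun ζ => Polynomial.X - Polynomial.C ζ,
      ∃ ζ : ℂ, (∃ m : ℕ, 0 < m ∧ ζ ^ m = 1) ∧ Polynomial.X - Polynomial.C ζ = f := by
    intro f hf
    obtain ⟨ζ, hζ, rfl⟩ := Multiset.mem_map.mp (Multiset.mem_of_mem_nsmul hf)
    exact ⟨ζ, ⟨_, hpos, (Polynomial.mem_nthRootsFinset hpos _).mp hζ⟩, rfl⟩
  obtain ⟨u, hu, hΔ⟩ := exists_associated_toLaurent_prod _ (fun f hf => by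
    obtain ⟨ζ, -, rfl⟩ := hmem f hf
    exact Polynomial.prime_X_sub_C ζ) h1
  obtain ⟨s, hs, rfl⟩ := Multiset.exists_map_eq_of_forall_mem
    (fun ζ : ℂ => Polynomial.X - Polynomial.C ζ)
    (fun ζ => ∃ m : ℕ, 0 < m ∧ ζ ^ m = 1) u fun f hf => hmem f (hu f hf)
  exact ⟨s, hs, hΔ⟩

/-! ### Orders of modules and annihilators -/

/-- A special case of the Cauchy–Binet formula. -/
theorem Matrix.dvd_det_mul {S : Type*} [CommRing S] {a b : ℕ} (A : Matrix (Fin b) (Fin a) S)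
    (P : Matrix (Fin a) (Fin b) S) {d : S} (h : ∀ f : Fin b → Fin a, d ∣ (P.submatrix f id).det) :
    d ∣ (A * P).det := by
  have hrow : A * P = fun i => ∑ j, A i j • P.row j := by
    ext i k
    simp [Matrix.mul_apply, Matrix.row]
  have : (A * P).det = Matrix.detRowAlternating.toMultilinearMap fun i => ∑ j, A i j • P.row j := by
    rw [hrow]; rfl
  -- Each row of `A * P` is a combination of rows of `P`, so multilinearity expands the determinant
  -- into multiples of the minors, one for each choice `f` of rows.
  rw [this, MultilinearMap.map_sum]
  refine Finset.dvd_sum fun f _ => ?_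
  rw [MultilinearMap.map_smul_univ]
  exact (h f).mul_left _

/-- The order of a module divides a power of every element of its annihilator. -/
theorem IsModuleOrder.dvd_pow {S : Type} [CommRing S] {M : Type} [AddCommGroup M] [Module S M]
    {Δ : S} (h : IsModuleOrder M Δ) {s : S} (hs : ∀ x : M, s • x = 0) : ∃ b : ℕ, Δ ∣ s ^ b := by
  obtain ⟨a, b, P, ⟨e⟩, hP⟩ := h
  have hmem (v : Fin b → S) : s • v ∈ Submodule.span S (Set.range P.row) := by
    rw [← Submodule.Quotient.mk_eq_zero, Submodule.Quotient.mk_smul]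
    apply e.symm.injective
    rw [map_smul, hs, map_zero]
  -- Since `s` kills the module, each `s • e_i` is a combination of relations. This gives `A * P = s
  -- • 1`, with determinant `s ^ b`.
  have hex (i : Fin b) : ∃ c : Fin a → S, ∑ j, c j • P.row j = s • Pi.single i 1 :=
    (Submodule.mem_span_range_iff_exists_fun S).mp (hmem _)
  choose A hA using hex
  have hAP : (Matrix.of A * P) = s • (1 : Matrix (Fin b) (Fin b) S) := by
    ext i k
    have := congrFun (hA i) k
    simp only [Finset.sum_apply, Pi.smul_apply, Matrix.row, smul_eq_mul] at this
    rw [Matrix.mul_apply, Matrix.smul_apply, Matrix.one_apply, smul_eq_mul]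
    simpa [Pi.single_apply, eq_comm] using this
  refine ⟨b, ?_⟩
  have := Matrix.dvd_det_mul (Matrix.of A) P ((hP Δ).mp dvd_rfl)
  simpa [hAP, Matrix.det_smul] using this

/-- The Noetherian hypothesis makes the relations finitely generated; unique factorization provides
the gcd of the minors. -/
theorem exists_isModuleOrder {S : Type} [CommRing S] [IsDomain S] [UniqueFactorizationMonoid S]
    [IsNoetherianRing S] (M : Type) [AddCommGroup M] [Module S M] [Module.Finite S M] :
    ∃ Δ : S, IsModuleOrder M Δ := by
  obtain ⟨b, φ, hφ⟩ := Module.Finite.exists_fin' S M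
  obtain ⟨a, P, hP⟩ := Submodule.fg_iff_exists_fin_generating_family.mp
    (IsNoetherian.noetherian (LinearMap.ker φ))
  let _ : NormalizedGCDMonoid S := Classical.choice inferInstance
  refine ⟨Finset.univ.gcd fun f : Fin b → Fin a => ((Matrix.of P).submatrix f id).det,
    a, b, Matrix.of P, ⟨?_⟩, fun d => ?_⟩
  · have : Set.range (Matrix.of P).row = Set.range P := rfl
    exact (φ.quotKerEquivOfSurjective hφ).symm ≪≫ₗ
      Submodule.quotEquivOfEq _ _ (by rw [this, hP])
  · simp [Finset.dvd_gcd_iff]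

/-! ### The group of a torus knot -/

section TorusRelations

variable {G : Type*} [Group G] {p q : ℕ} (x : ZMod q × ZMod p → G)

/-- The product `x (k + n - 1, 0) * ⋯ * x (k + 1, 0) * x (k, 0)` of consecutive over-arcs. -/
def overProd (k : ZMod q) : ℕ → G
  | 0 => 1
  | n + 1 => x (k + n, 0) * overProd k n

theorem overProd_one (k : ZMod q) : overProd x k 1 = x (k, 0) := by simp [overProd]

theorem overProd_add (k : ZMod q) (m n : ℕ) :
    overProd x k (m + n) = overProd x (k + m) n * overProd x k m := by
  induction n with
  | zero => simp [overProd]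
  | succ n ih => rw [← add_assoc, overProd, overProd, ih, mul_assoc, Nat.cast_add, add_assoc]

theorem map_overProd {H : Type*} [Monoid H] (f : G →* H) {t : H} (hf : ∀ c, f (x c) = t)
    (k : ZMod q) (n : ℕ) : f (overProd x k n) = t ^ n := by
  induction n with
  | zero => simp [overProd]
  | succ n ih => rw [overProd, map_mul, ih, hf, pow_succ']

/-- Period `q` is built into the index set `ZMod q`; no relation is needed, unlike for period `p`.
-/
theorem overProd_mul_of_left (n : ℕ) : overProd x 0 (q * n) = overProd x 0 q ^ n := by
  induction n with
  | zero => simp [overProd]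
  | succ n ih =>
    rw [mul_add, mul_one, overProd_add, ih, pow_succ']
    simp

variable (hx : ∀ c : ZMod q × ZMod p, x (c.1, 0) * x c = x (c.1 + 1, c.2 - 1) * x (c.1, 0))
include hx

theorem overProd_conj (k : ZMod q) (i : ZMod p) (n : ℕ) :
    x (k + n, i - n) * overProd x k n = overProd x k n * x (k, i) := by
  induction n with
  | zero => simp [overProd]
  | succ n ih =>
    have := hx (k + n, i - n)
    simp only at this
    rw [overProd, mul_assoc, ← ih, ← mul_assoc, ← mul_assoc, this, Nat.cast_succ, Nat.cast_succ,
      ← add_assoc, ← sub_sub]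

/-- After `p` factors the strand position returns to `0`, so `overProd x k p` conjugates `x (k, 0)`
to `x (k + p, 0)`. Writing the product of `p + 1` over-arcs in two ways and cancelling `x (k, 0)`
gives the claim. -/
theorem overProd_period_succ (k : ZMod q) : overProd x (k + 1) p = overProd x k p := by
  have h1 := overProd_add x k 1 p
  have h2 := overProd_add x k p 1
  have h3 := overProd_conj x hx k 0 p
  rw [add_comm 1 p, h2, overProd_one, overProd_one, Nat.cast_one] at h1
  rw [ZMod.natCast_self, sub_zero, h1] at h3
  exact mul_right_cancel h3

theorem overProd_period (k : ℕ) : overProd x (k : ZMod q) p = overProd x 0 p := by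
  induction k with
  | zero => simp
  | succ k ih => rw [Nat.cast_succ, overProd_period_succ x hx, ih]

theorem overProd_mul_of_right (n : ℕ) : overProd x 0 (p * n) = overProd x 0 p ^ n := by
  induction n with
  | zero => simp [overProd]
  | succ n ih =>
    rw [mul_add, mul_one, overProd_add, ih, pow_succ', zero_add, overProd_period x hx]

/-- A group generated by elements `x c` that satisfy the Wirtinger relations of a torus knot is
generated by the two elements `P` and `Q` with `P ^ q = Q ^ p`. -/
theorem exists_torus_generators (hp : 0 < p) (hq : 0 < q) (hpq : p.Coprime q) :
    ∃ (P Q : G) (a b : ℕ), a * p = b * q + 1 ∧ P ^ q = Q ^ p ∧ P ^ a = x (0, 0) * Q ^ b ∧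
      (∀ c, ∃ g ∈ Subgroup.closure {P, Q}, x c = g * x (0, 0) * g⁻¹) ∧
      ∀ (f : G →* Multiplicative ℤ) (t : Multiplicative ℤ), (∀ c, f (x c) = t) → f P = t ^ p := by
  have : NeZero p := ⟨hp.ne'⟩
  have : NeZero q := ⟨hq.ne'⟩
  obtain ⟨a, b, hab⟩ : ∃ a b : ℕ, a * p = b * q + 1 := by
    obtain ⟨m, h0, h1⟩ := Nat.chineseRemainder hpq 0 1
    have h0' : p ∣ m + p * q := (Nat.modEq_zero_iff_dvd.mp h0).add (dvd_mul_right _ _)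
    -- Adding `p * q` keeps both congruences and prevents truncation in the subtraction of `1`; for
    -- `q = 1` the residue `m` may be `0`.
    have hpos : 1 ≤ m + p * q := (Nat.mul_pos hp hq).trans_le (Nat.le_add_left _ _)
    have h1' : q ∣ m + p * q - 1 := by
      refine (Nat.modEq_iff_dvd' hpos).mp ?_
      simpa [Nat.ModEq] using h1.symm
    obtain ⟨a, ha⟩ := h0'
    obtain ⟨b, hb⟩ := h1'
    exact ⟨a, b, by rw [mul_comm a, ← ha, mul_comm b, ← hb]; omega⟩
  -- Both sides are the product of `a * p = b * q + 1` consecutive over-arcs.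
  have hPa : overProd x 0 p ^ a = x (0, 0) * overProd x 0 q ^ b := by
    rw [← overProd_mul_of_right x hx, ← overProd_mul_of_left, mul_comm p, hab, mul_comm b,
      overProd_add, overProd_one]
    simp
  refine ⟨overProd x 0 p, overProd x 0 q, a, b, hab, ?_, hPa, ?_,
    fun f t hf => map_overProd x f hf 0 p⟩
  · rw [← overProd_mul_of_right x hx, ← overProd_mul_of_left, mul_comm]
  · set K := Subgroup.closure {overProd x 0 p, overProd x 0 q}
    have hP : overProd x 0 p ∈ K := Subgroup.subset_closure (by simp)
    have hQ : overProd x 0 q ∈ K := Subgroup.subset_closure (by simp)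
    have h0 : x (0, 0) ∈ K := by
      rw [← mul_inv_eq_iff_eq_mul.mpr hPa]
      exact K.mul_mem (K.pow_mem hP a) (K.inv_mem (K.pow_mem hQ b))
    have hy (k : ZMod q) : x (k, 0) ∈ K := by
      -- This length is `0` modulo `p` and `k` modulo `q`, so a power of `P` conjugates `x (0, 0)`
      -- to `x (k, 0)`.
      have h1 := overProd_conj x hx 0 0 (p * (a * k.val))
      have h2 : ((p * (a * k.val) : ℕ) : ZMod q) = k := by
        rw [← mul_assoc, mul_comm p, hab]
        simp
      rw [h2, overProd_mul_of_right x hx, zero_add, Nat.cast_mul p, ZMod.natCast_self, zero_mul,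
        sub_zero, ← eq_mul_inv_iff_mul_eq] at h1
      rw [h1]
      exact K.mul_mem (K.mul_mem (K.pow_mem hP _) h0) (K.inv_mem (K.pow_mem hP _))
    have hF (n : ℕ) : overProd x 0 n ∈ K := by
      induction n with
      | zero => exact K.one_mem
      | succ n ih => exact K.mul_mem (hy _) ih
    rintro ⟨k, i⟩
    -- After `n` factors the arc `(0, 0)` has become `(n, -n)`; coprimality lets this reach every
    -- `(k, i)`.
    obtain ⟨n, hnp, hnq⟩ := Nat.chineseRemainder hpq (-i).val k.val
    refine ⟨overProd x 0 n, hF n, ?_⟩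
    have h1 : (n : ZMod p) = -i := by
      simpa using (ZMod.natCast_eq_natCast_iff _ _ _).mpr hnp
    have h2 : (n : ZMod q) = k := by
      simpa using (ZMod.natCast_eq_natCast_iff _ _ _).mpr hnq
    have := overProd_conj x hx 0 0 n
    rw [h1, h2, zero_add, zero_sub, neg_neg] at this
    exact eq_mul_inv_iff_mul_eq.mpr this

end TorusRelations

theorem commute_map_of_closure_eq_top {G H : Type*} [Group G] [Group H] {s : Set G}
    (hs : Subgroup.closure s = ⊤) (f : G →* H) {y : H} (h : ∀ g ∈ s, Commute y (f g)) (g : G) :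
    Commute y (f g) := by
  have : Subgroup.closure s ≤ (Subgroup.centralizer {y}).comap f := by
    rw [Subgroup.closure_le]
    intro g hg
    rw [SetLike.mem_coe, Subgroup.mem_comap, Subgroup.mem_centralizer_singleton_iff]
    exact (h g hg).symm
  have hg : g ∈ (Subgroup.centralizer {y}).comap f := this (hs ▸ Subgroup.mem_top g)
  exact (Subgroup.mem_centralizer_singleton_iff.mp hg).symm

theorem commute_map_map_of_closure_eq_top {G H : Type*} [Group G] [Group H] {s : Set G}
    (hs : Subgroup.closure s = ⊤) (f : G →* H) (h : ∀ a ∈ s, ∀ b ∈ s, Commute (f a) (f b))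
    (g g' : G) : Commute (f g) (f g') :=
  commute_map_of_closure_eq_top hs f (fun b hb =>
    (commute_map_of_closure_eq_top hs f (fun a ha => h b hb a ha) g).symm) g'

/-- Modulo the central `P ^ q`, the elements `P ^ a` and `Q ^ b` recover `P` and `Q` because `a p =
b q + 1`. This triple is the generating set on which the normal form is computed. -/
theorem closure_triple_eq_top {G : Type*} [Group G] {P Q : G} {p q a b : ℕ}
    (hab : a * p = b * q + 1) (hPQ : P ^ q = Q ^ p) (h : Subgroup.closure {P, Q} = ⊤) :
    Subgroup.closure {P ^ a, (Q ^ b)⁻¹, P ^ q} = ⊤ := by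
  set K := Subgroup.closure {P ^ a, (Q ^ b)⁻¹, P ^ q}
  have h1 : P ^ a ∈ K := Subgroup.subset_closure (by simp)
  have h2 : (Q ^ b)⁻¹ ∈ K := Subgroup.subset_closure (by simp)
  have h3 : P ^ q ∈ K := Subgroup.subset_closure (by simp)
  rw [eq_top_iff, ← h, Subgroup.closure_le]
  rintro g (hg | hg) <;> rw [hg]
  · rw [SetLike.mem_coe]
    have : P = ((P ^ q) ^ b)⁻¹ * (P ^ a) ^ p := by
      rw [← pow_mul, ← pow_mul, hab, mul_comm q, pow_succ, inv_mul_cancel_left]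
    rw [this]
    exact K.mul_mem (K.inv_mem (K.pow_mem h3 _)) (K.pow_mem h1 _)
  · rw [SetLike.mem_coe]
    have : Q = (P ^ q) ^ a * (Q ^ b)⁻¹ ^ q := by
      rw [hPQ, ← pow_mul, inv_pow, ← pow_mul, mul_comm p, hab, pow_succ', mul_inv_cancel_right]
    rw [this]
    exact K.mul_mem (K.pow_mem h3 _) (K.pow_mem h2 _)

/-! ### Triviality of the action of the centre on twisted homology -/

namespace WirtingerData

section CrossedAction

open LaurentPolynomial

variable {ι κ : Type} (W : WirtingerData ι κ)
  {R : Type} [CommRing R] {n : Type} [Fintype n] [DecidableEq n]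
  (γ : W.KnotGroup →* Matrix.GeneralLinearGroup n R)

theorem closure_range_gen : Subgroup.closure (Set.range W.gen) = ⊤ :=
  PresentedGroup.closure_range_of _

theorem twist_one : W.twist γ 1 = 1 := by
  simp [twist]

theorem twist_mul_twist_inv (g : W.KnotGroup) : W.twist γ g * W.twist γ g⁻¹ = 1 := by
  rw [← twist_mul, mul_inv_cancel, twist_one]

theorem twist_inv_mul_twist (g : W.KnotGroup) : W.twist γ g⁻¹ * W.twist γ g = 1 := by
  rw [← twist_mul, inv_mul_cancel, twist_one]

/-- The cokernel of `∂₂`. -/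
abbrev RelativeChains : Type :=
  (ι →₀ (n → R[T;T⁻¹])) ⧸ LinearMap.range (W.boundary₂ γ)

/-- The class of `v ⊗ x_i` modulo the image of `∂₂`. -/
noncomputable def chainClass (i : ι) : (n → R[T;T⁻¹]) →ₗ[R[T;T⁻¹]] W.RelativeChains γ :=
  (LinearMap.range (W.boundary₂ γ)).mkQ ∘ₗ Finsupp.lsingle i

theorem chainClass_relation (c : κ) (v : n → R[T;T⁻¹]) :
    W.chainClass γ (W.overArc c) v
        + W.chainClass γ (W.inArc c) (Matrix.vecMul v (W.twist γ (W.gen (W.overArc c))))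
      = W.chainClass γ (W.outArc c) v
        + W.chainClass γ (W.overArc c) (Matrix.vecMul v (W.twist γ (W.gen (W.outArc c)))) := by
  have h1 : W.boundary₂ γ (Finsupp.single c v)
      = Finsupp.single (W.overArc c) v
        + Finsupp.single (W.inArc c) (Matrix.vecMul v (W.twist γ (W.gen (W.overArc c))))
        - (Finsupp.single (W.outArc c) v
          + Finsupp.single (W.overArc c)
            (Matrix.vecMul v (W.twist γ (W.gen (W.outArc c))))) := by
    simp only [boundary₂, Finsupp.lsum_single, LinearMap.sub_apply, LinearMap.add_apply,
      LinearMap.comp_apply, Matrix.vecMulLinear_apply, Finsupp.lsingle_apply, sub_sub]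
  have h : (LinearMap.range (W.boundary₂ γ)).mkQ (W.boundary₂ γ (Finsupp.single c v)) = 0 := by
    rw [Submodule.mkQ_apply, Submodule.Quotient.mk_eq_zero]
    exact LinearMap.mem_range_self _ _
  rw [h1, map_sub, map_add, map_add, sub_eq_zero] at h
  exact h

/-- The action of a generator on `coker ∂₂ ⊕ C₀` that combines the crossed homomorphism
`x_i ↦ (v ↦ v ⊗ x_i)` with the twisted action. -/
noncomputable def crossedGen (i : ι) :
    (W.RelativeChains γ × (n → R[T;T⁻¹])) ≃ₗ[R[T;T⁻¹]] (W.RelativeChains γ × (n → R[T;T⁻¹])) where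
  toFun e := (e.1 + W.chainClass γ i e.2, Matrix.vecMul e.2 (W.twist γ (W.gen i)))
  invFun e := (e.1 - W.chainClass γ i (Matrix.vecMul e.2 (W.twist γ (W.gen i)⁻¹)),
    Matrix.vecMul e.2 (W.twist γ (W.gen i)⁻¹))
  map_add' e f := by
    ext1
    · simp only [Prod.fst_add, Prod.snd_add, map_add]; abel
    · simp only [Prod.snd_add, Matrix.add_vecMul]
  map_smul' s e := by
    ext1
    · simp only [Prod.smul_fst, Prod.smul_snd, map_smul, smul_add, RingHom.id_apply]
    · simp only [Prod.smul_snd, Matrix.smul_vecMul, RingHom.id_apply]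
  left_inv e := by
    simp [Matrix.vecMul_vecMul, twist_mul_twist_inv]
  right_inv e := by
    simp [Matrix.vecMul_vecMul, twist_inv_mul_twist]

theorem crossedGen_apply (i : ι) (m : W.RelativeChains γ) (v : n → R[T;T⁻¹]) :
    W.crossedGen γ i (m, v) =
      (m + W.chainClass γ i v, Matrix.vecMul v (W.twist γ (W.gen i))) := rfl

/-- The vanishing of `∂₂` of a relator in the cokernel is exactly the Fox-calculus condition for a
crossed homomorphism to respect that relator. The order of the factors is reversed because the
action is from the right. -/
theorem crossedGen_relation (c : κ) :
    W.crossedGen γ (W.inArc c) * W.crossedGen γ (W.overArc c)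
      = W.crossedGen γ (W.overArc c) * W.crossedGen γ (W.outArc c) := by
  refine LinearEquiv.ext fun ⟨m, v⟩ => ?_
  simp only [LinearEquiv.mul_apply, crossedGen_apply, Matrix.vecMul_vecMul, add_assoc,
    chainClass_relation, ← twist_mul, gen_relation]

/-- The right action of `π` on `coker ∂₂ ⊕ C₀`. -/
noncomputable def crossedAction : W.KnotGroup →*
    ((W.RelativeChains γ × (n → R[T;T⁻¹])) ≃ₗ[R[T;T⁻¹]]
      (W.RelativeChains γ × (n → R[T;T⁻¹])))ᵐᵒᵖ :=
  PresentedGroup.toGroup (f := fun i => MulOpposite.op (W.crossedGen γ i)) (by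
    rintro r ⟨c, rfl⟩
    simp only [relator, map_mul, map_inv, FreeGroup.lift_apply_of]
    rw [mul_inv_eq_one, mul_inv_eq_iff_eq_mul, ← MulOpposite.op_mul, ← MulOpposite.op_mul,
      crossedGen_relation])

theorem crossedAction_gen (i : ι) :
    W.crossedAction γ (W.gen i) = MulOpposite.op (W.crossedGen γ i) :=
  PresentedGroup.toGroup.of _

/-- The map `D` is the value at `g` of the crossed homomorphism extending `x_i ↦ (v ↦ v ⊗ x_i)`. For
central `g` it serves as a chain homotopy. -/
theorem exists_crossedAction_eq (g : W.KnotGroup) :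
    ∃ D : (n → R[T;T⁻¹]) →ₗ[R[T;T⁻¹]] W.RelativeChains γ, ∀ m v,
      (W.crossedAction γ g).unop (m, v) = (m + D v, Matrix.vecMul v (W.twist γ g)) := by
  have hg : g ∈ Subgroup.closure (Set.range W.gen) := W.closure_range_gen ▸ Subgroup.mem_top g
  induction hg using Subgroup.closure_induction with
  | mem g hg =>
    obtain ⟨i, rfl⟩ := hg
    exact ⟨W.chainClass γ i, fun m v => by
      rw [crossedAction_gen, MulOpposite.unop_op, crossedGen_apply]⟩
  | one => exact ⟨0, fun m v => by simp [twist_one]⟩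
  | mul g h _ _ ihg ihh =>
    obtain ⟨D, hD⟩ := ihg
    obtain ⟨D', hD'⟩ := ihh
    refine ⟨D + D' ∘ₗ Matrix.vecMulLinear (W.twist γ g), fun m v => ?_⟩
    rw [map_mul, MulOpposite.unop_mul, LinearEquiv.mul_apply, hD, hD', Matrix.vecMul_vecMul,
      ← twist_mul]
    simp [add_assoc]
  | inv g _ ih =>
    obtain ⟨D, hD⟩ := ih
    refine ⟨-(D ∘ₗ Matrix.vecMulLinear (W.twist γ g⁻¹)), fun m v => ?_⟩
    rw [map_inv, MulOpposite.unop_inv, LinearEquiv.coe_inv, LinearEquiv.symm_apply_eq, hD]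
    simp [Matrix.vecMul_vecMul, twist_inv_mul_twist]

/-- The chain map by which a central element acts on `C₁`. -/
noncomputable def centralAction (z : W.KnotGroup) :
    (ι →₀ (n → R[T;T⁻¹])) →ₗ[R[T;T⁻¹]] (ι →₀ (n → R[T;T⁻¹])) :=
  Finsupp.mapRange.linearMap (Matrix.vecMulLinear (W.twist γ z))

theorem boundary₁_centralAction {z : W.KnotGroup} (hz : ∀ g, z * g = g * z)
    (c : ι →₀ (n → R[T;T⁻¹])) :
    W.boundary₁ γ (W.centralAction γ z c) = Matrix.vecMul (W.boundary₁ γ c) (W.twist γ z) := by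
  suffices W.boundary₁ γ ∘ₗ W.centralAction γ z
      = Matrix.vecMulLinear (W.twist γ z) ∘ₗ W.boundary₁ γ from LinearMap.congr_fun this c
  refine Finsupp.lhom_ext fun i v => ?_
  simp only [LinearMap.comp_apply, centralAction, Finsupp.mapRange.linearMap_apply,
    Finsupp.mapRange_single, boundary₁, Finsupp.lsum_single, LinearMap.sub_apply,
    Matrix.vecMulLinear_apply, LinearMap.id_apply, Matrix.vecMul_vecMul, Matrix.sub_vecMul,
    ← twist_mul, hz]

/-- A central element acts trivially on the first homology. -/
theorem centralAction_sub_mem {z : W.KnotGroup} (hz : ∀ g, z * g = g * z)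
    {c : ι →₀ (n → R[T;T⁻¹])} (hc : W.boundary₁ γ c = 0) :
    W.centralAction γ z c - c ∈ LinearMap.range (W.boundary₂ γ) := by
  obtain ⟨D, hD⟩ := W.exists_crossedAction_eq γ z
  -- Applying `z x_i = x_i z` to `(0, v)` and comparing first components gives `D v + [v z ⊗ x_i] =
  -- [v ⊗ x_i] + D (v x_i)`. Hence `z - 1 = D ∂₁` modulo the image of `∂₂`.
  have key : (LinearMap.range (W.boundary₂ γ)).mkQ ∘ₗ (W.centralAction γ z - LinearMap.id)
      = D ∘ₗ W.boundary₁ γ := by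
    refine Finsupp.lhom_ext fun i v => ?_
    have h := congrArg (fun e => (e.unop (0, v)).1)
      (congrArg (W.crossedAction γ) (hz (W.gen i)))
    simp only [map_mul, MulOpposite.unop_mul, LinearEquiv.mul_apply, hD, crossedAction_gen,
      MulOpposite.unop_op, crossedGen_apply, zero_add] at h
    simp only [LinearMap.comp_apply, LinearMap.sub_apply, LinearMap.id_apply, centralAction,
      Finsupp.mapRange.linearMap_apply, Finsupp.mapRange_single, boundary₁, Finsupp.lsum_single,
      map_sub, Matrix.vecMulLinear_apply]
    simp only [chainClass, LinearMap.comp_apply, Finsupp.lsingle_apply] at h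
    rw [sub_eq_sub_iff_add_eq_add, add_comm, h, add_comm]
  have := LinearMap.congr_fun key c
  rw [LinearMap.comp_apply, LinearMap.comp_apply, hc, map_zero, Submodule.mkQ_apply,
    Submodule.Quotient.mk_eq_zero] at this
  exact this

theorem centralAction_centralAction {z : W.KnotGroup}
    (hγ : ((γ z : Matrix n n R) - 1) * ((γ z : Matrix n n R) - 1) = 0)
    (c : ι →₀ (n → R[T;T⁻¹])) :
    W.centralAction γ z (W.centralAction γ z c)
      = (2 * T (W.epsilon z).toAdd : R[T;T⁻¹]) • W.centralAction γ z c
        - ((T (W.epsilon z).toAdd) ^ 2 : R[T;T⁻¹]) • c := by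
  have hmat : W.twist γ z * W.twist γ z = (2 * T (W.epsilon z).toAdd : R[T;T⁻¹]) • W.twist γ z
      - ((T (W.epsilon z).toAdd) ^ 2 : R[T;T⁻¹]) • (1 : Matrix n n R[T;T⁻¹]) := by
    have h1 : (γ z : Matrix n n R) * (γ z : Matrix n n R)
        = (γ z : Matrix n n R) + (γ z : Matrix n n R) - 1 := by
      rw [sub_mul, mul_sub, mul_one, one_mul] at hγ
      rw [← sub_eq_zero, ← hγ]
      abel
    have h2 := congrArg (LaurentPolynomial.C (R := R)).mapMatrix h1
    rw [map_mul, map_sub, map_add, map_one] at h2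
    rw [twist, Matrix.smul_mul, Matrix.mul_smul, h2]
    module
  ext1 i
  simp only [centralAction, Finsupp.mapRange.linearMap_apply, Finsupp.mapRange_apply,
    Finsupp.sub_apply, Finsupp.smul_apply, Matrix.vecMulLinear_apply, Matrix.vecMul_vecMul, hmat,
    Matrix.vecMul_sub, Matrix.vecMul_smul, Matrix.vecMul_one]

/-- If a central element `z` has unipotent image, `(t ^ ε(z) - 1) ^ 2` kills the twisted
homology. -/
theorem smul_twistedH1_eq_zero {z : W.KnotGroup} (hz : ∀ g, z * g = g * z)
    (hγ : ((γ z : Matrix n n R) - 1) * ((γ z : Matrix n n R) - 1) = 0) (x : W.TwistedH1 γ) :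
    ((T (W.epsilon z).toAdd - 1) ^ 2 : R[T;T⁻¹]) • x = 0 := by
  obtain ⟨⟨c, hc⟩, rfl⟩ := Submodule.Quotient.mk_surjective _ x
  rw [← Submodule.Quotient.mk_smul, Submodule.Quotient.mk_eq_zero]
  change ((T (W.epsilon z).toAdd - 1) ^ 2 : R[T;T⁻¹]) • c ∈ LinearMap.range (W.boundary₂ γ)
  rw [LinearMap.mem_ker] at hc
  have h1 := W.centralAction_sub_mem γ hz hc
  have h2 := W.centralAction_sub_mem γ hz (c := W.centralAction γ z c) (by
    rw [boundary₁_centralAction W γ hz, hc, Matrix.zero_vecMul])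
  -- With `τ = t ^ ε(z)` and `Z` the action of `z`, the sum is `2τ(Zc - c) - (Z²c - Zc) - (Zc - c)`.
  -- Substituting `Z² = 2τZ - τ²` leaves `(τ - 1)² c`.
  have h3 := sub_mem (sub_mem (Submodule.smul_mem _ (2 * T (W.epsilon z).toAdd : R[T;T⁻¹]) h1) h2) h1
  rw [W.centralAction_centralAction γ hγ] at h3
  convert h3 using 1
  module

instance finite_twistedH1 [Finite ι] [IsNoetherianRing R] :
    Module.Finite R[T;T⁻¹] (W.TwistedH1 γ) := by
  have : IsNoetherian R[T;T⁻¹] (ι →₀ (n → R[T;T⁻¹])) :=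
    isNoetherian_of_isNoetherianRing_of_finite _ _
  infer_instance

end CrossedAction

end WirtingerData

/-! ### Linear algebra of `2 × 2` matrices -/

section TwoByTwo

variable {K : Type*} [Field K]

/-- The commutant of a non-scalar `2 × 2` matrix is commutative: `A` and `B` have traceless parts
proportional to that of `M`. The quantities `e1`, `e2`, `e3` are the minors expressing that these
parts are dependent, and up to sign the entries of `A * B - B * A`. -/
theorem Matrix.exists_eq_smul_one_of_commute {M A B : Matrix (Fin 2) (Fin 2) K}
    (hA : M * A = A * M) (hB : M * B = B * M) (hAB : A * B ≠ B * A) :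
    ∃ s : K, M = s • 1 := by
  simp only [← Matrix.ext_iff, Fin.forall_fin_two, Matrix.mul_apply, Fin.sum_univ_two] at hA hB
  obtain ⟨⟨a1, a2⟩, a3, -⟩ := hA
  obtain ⟨⟨b1, b2⟩, b3, -⟩ := hB
  by_contra! hM
  refine hAB ?_
  have key : M 0 1 ≠ 0 ∨ M 1 0 ≠ 0 ∨ M 0 0 - M 1 1 ≠ 0 := by
    by_contra! h
    refine hM (M 0 0) ?_
    ext i j
    fin_cases i <;> fin_cases j <;> simp [h.1, h.2.1, ← sub_eq_zero.mp h.2.2]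
  have e1 : A 0 1 * B 1 0 - B 0 1 * A 1 0 = 0 := by
    rcases key with h | h | h <;> refine (mul_eq_zero.mp ?_).resolve_left h
    · linear_combination A 0 1 * b1 - B 0 1 * a1
    · linear_combination -B 1 0 * a1 + A 1 0 * b1
    · linear_combination -A 0 1 * b3 - (B 0 0 - B 1 1) * a1 - A 1 0 * b2
  have e2 : (A 0 0 - A 1 1) * B 0 1 - (B 0 0 - B 1 1) * A 0 1 = 0 := by
    rcases key with h | h | h <;> refine (mul_eq_zero.mp ?_).resolve_left h
    · linear_combination A 0 1 * b2 - B 0 1 * a2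
    · linear_combination B 0 1 * a3 + A 1 0 * b2 + (B 0 0 - B 1 1) * a1
    · linear_combination (A 0 0 - A 1 1) * b2 - (B 0 0 - B 1 1) * a2
  have e3 : (A 0 0 - A 1 1) * B 1 0 - (B 0 0 - B 1 1) * A 1 0 = 0 := by
    rcases key with h | h | h <;> refine (mul_eq_zero.mp ?_).resolve_left h
    · linear_combination -B 1 0 * a2 - A 0 1 * b3 - (B 0 0 - B 1 1) * a1
    · linear_combination B 1 0 * a3 - A 1 0 * b3
    · linear_combination (B 0 0 - B 1 1) * a3 - (A 0 0 - A 1 1) * b3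
  ext i j
  fin_cases i <;> fin_cases j <;> simp only [Fin.zero_eta, Fin.mk_one, Matrix.mul_apply, Fin.sum_univ_two, Fin.isValue]
  · linear_combination e1
  · linear_combination e2
  · linear_combination -e3
  · linear_combination -e1

theorem Matrix.mulVec_eq_smul_iff_fin_two {M : Matrix (Fin 2) (Fin 2) K} {w : Fin 2 → K} {c : K} :
    M.mulVec w = c • w ↔
      M 0 0 * w 0 + M 0 1 * w 1 = c * w 0 ∧ M 1 0 * w 0 + M 1 1 * w 1 = c * w 1 := by
  simp [funext_iff, Fin.forall_fin_two]

theorem ne_zero_iff_fin_two {w : Fin 2 → K} : w ≠ 0 ↔ w 0 ≠ 0 ∨ w 1 ≠ 0 := by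
  rw [Function.ne_iff]
  simp [Fin.exists_fin_two]

theorem Matrix.eigenvalue_eq_one_of_trace_eq_two {M : Matrix (Fin 2) (Fin 2) K} (hdet : M.det = 1)
    (htr : M.trace = 2) {w : Fin 2 → K} (hw : w ≠ 0) {c : K} (h : M.mulVec w = c • w) : c = 1 := by
  rw [Matrix.mulVec_eq_smul_iff_fin_two] at h
  rw [Matrix.det_fin_two] at hdet
  rw [Matrix.trace_fin_two] at htr
  obtain ⟨h0, h1⟩ := h
  have : (c - 1) ^ 2 = 0 := by
    rcases ne_zero_iff_fin_two.mp hw with h | h <;> refine (mul_eq_zero.mp ?_).resolve_right h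
    · linear_combination (M 1 1 - c) * h0 - M 0 1 * h1 - w 0 * hdet + c * w 0 * htr
    · linear_combination (M 0 0 - c) * h1 - M 1 0 * h0 - w 1 * hdet + c * w 1 * htr
  simpa [sub_eq_zero] using this

/-- Both `M - 1` and `N - 1` are traceless and kill `w`, so they are nilpotent with image in the
line of `w`. Such matrices are proportional. -/
theorem Matrix.commute_of_mulVec_eq_self {M N : Matrix (Fin 2) (Fin 2) K}
    (hM : M.trace = 2) (hN : N.trace = 2) {w : Fin 2 → K} (hw : w ≠ 0)
    (hMw : M.mulVec w = (1 : K) • w) (hNw : N.mulVec w = (1 : K) • w) : M * N = N * M := by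
  rw [Matrix.mulVec_eq_smul_iff_fin_two] at hMw hNw
  rw [Matrix.trace_fin_two] at hM hN
  obtain ⟨m0, m1⟩ := hMw
  obtain ⟨n0, n1⟩ := hNw
  obtain ⟨x, hx⟩ : ∃ x, M 0 0 = 1 + x := ⟨M 0 0 - 1, by ring⟩
  obtain ⟨y, hy⟩ : ∃ y, N 0 0 = 1 + y := ⟨N 0 0 - 1, by ring⟩
  have hx' : M 1 1 = 1 - x := by linear_combination hM - hx
  have hy' : N 1 1 = 1 - y := by linear_combination hN - hy
  rw [hx] at m0
  rw [hx'] at m1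
  rw [hy] at n0
  rw [hy'] at n1
  have hcases := ne_zero_iff_fin_two.mp hw
  have e1 : x * N 0 1 - y * M 0 1 = 0 := by
    rcases hcases with h | h <;> refine (mul_eq_zero.mp ?_).resolve_left h
    · linear_combination N 0 1 * m0 - M 0 1 * n0
    · linear_combination x * n0 - y * m0
  have e2 : x * N 1 0 - y * M 1 0 = 0 := by
    rcases hcases with h | h <;> refine (mul_eq_zero.mp ?_).resolve_left h
    · linear_combination x * n1 - y * m1
    · linear_combination M 1 0 * n1 - N 1 0 * m1
  have e3 : M 0 1 * N 1 0 - M 1 0 * N 0 1 = 0 := by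
    rcases hcases with h | h <;> refine (mul_eq_zero.mp ?_).resolve_left h
    · linear_combination M 0 1 * n1 - N 0 1 * m1 - w 1 * e1
    · linear_combination N 1 0 * m0 - M 1 0 * n0 - w 0 * e2
  ext i j
  fin_cases i <;> fin_cases j <;>
    simp only [Fin.zero_eta, Fin.mk_one, Matrix.mul_apply, Fin.sum_univ_two, Fin.isValue, hx, hy,
      hx', hy']
  · linear_combination e3
  · linear_combination 2 * e1
  · linear_combination -2 * e2
  · linear_combination -e3

/-- Cayley–Hamilton: the characteristic polynomial is `(X - 1)²`. -/
theorem Matrix.sub_one_mul_sub_one {u : Matrix (Fin 2) (Fin 2) K} (hdet : u.det = 1)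
    (htr : u.trace = 2) : (u - 1) * (u - 1) = 0 := by
  rw [Matrix.det_fin_two] at hdet
  rw [Matrix.trace_fin_two] at htr
  ext i j
  fin_cases i <;> fin_cases j <;> simp [Matrix.mul_apply, Fin.sum_univ_two]
  · linear_combination u 0 0 * htr - hdet
  · linear_combination u 0 1 * htr
  · linear_combination u 1 0 * htr
  · linear_combination u 1 1 * htr - hdet

theorem exists_eq_smul_of_det_eq_zero {e f : Fin 2 → K} (he : e ≠ 0)
    (h : (!![e 0, f 0; e 1, f 1]).det = 0) : ∃ c : K, f = c • e := by
  rw [Matrix.det_fin_two_of] at h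
  rcases ne_zero_iff_fin_two.mp he with h0 | h0
  · refine ⟨f 0 / e 0, ?_⟩
    ext i
    fin_cases i
    · simp [h0]
    · simp only [Fin.mk_one, Fin.isValue, Pi.smul_apply, smul_eq_mul]
      field_simp
      linear_combination h
  · refine ⟨f 1 / e 1, ?_⟩
    ext i
    fin_cases i
    · simp only [Fin.zero_eta, Fin.isValue, Pi.smul_apply, smul_eq_mul]
      field_simp
      linear_combination -h
    · simp [h0]

theorem Matrix.exists_mulVec_eq_smul [IsAlgClosed K] (M : Matrix (Fin 2) (Fin 2) K) :
    ∃ (c : K) (w : Fin 2 → K), w ≠ 0 ∧ M.mulVec w = c • w := by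
  obtain ⟨c, hc⟩ := Module.End.exists_eigenvalue (Matrix.toLin' M)
  obtain ⟨w, hw⟩ := hc.exists_hasEigenvector
  exact ⟨c, w, hw.2, by simpa using hw.apply_eq_smul⟩

theorem Matrix.pow_mulVec_eq_smul {M : Matrix (Fin 2) (Fin 2) K} {w : Fin 2 → K} {c : K}
    (h : M.mulVec w = c • w) (k : ℕ) : (M ^ k).mulVec w = c ^ k • w := by
  induction k with
  | zero => simp
  | succ k ih => rw [pow_succ, ← Matrix.mulVec_mulVec, h, Matrix.mulVec_smul, ih, smul_smul, pow_succ']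

theorem Matrix.eigenvalue_pow_eq_one {M : Matrix (Fin 2) (Fin 2) K} {w : Fin 2 → K} {c : K}
    (hw : w ≠ 0) (h : M.mulVec w = c • w) {k : ℕ} (hk : M ^ k = 1) : c ^ k = 1 := by
  have := Matrix.pow_mulVec_eq_smul h k
  rw [hk, Matrix.one_mulVec] at this
  refine smul_left_injective K hw ?_
  simpa using this.symm

/-- Two matrices in `SL₂` without a common eigenvector are simultaneously conjugate to an upper and
a lower triangular matrix; if they have finite order and their product has trace `2`, the entries
of these are integral. -/
theorem exists_riley_form {U V : Matrix (Fin 2) (Fin 2) ℂ} (hU : U.det = 1) (hV : V.det = 1)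
    {k l : ℕ} (hk : 0 < k) (hl : 0 < l) (hUk : U ^ k = 1) (hVl : V ^ l = 1)
    (htr : (U * V).trace = 2)
    (hno : ∀ (w : Fin 2 → ℂ) (c d : ℂ), w ≠ 0 → U.mulVec w = c • w → V.mulVec w ≠ d • w) :
    ∃ (B : GL (Fin 2) ℂ) (M N : Matrix (Fin 2) (Fin 2) ℂ), U * (B : Matrix (Fin 2) (Fin 2) ℂ) = B * M ∧
      V * (B : Matrix (Fin 2) (Fin 2) ℂ) = B * N ∧ ∀ i j, IsIntegral ℤ (M i j) ∧ IsIntegral ℤ (N i j) := by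
  obtain ⟨c, e, he, hUe⟩ := U.exists_mulVec_eq_smul
  obtain ⟨d, f, hf, hVf⟩ := V.exists_mulVec_eq_smul
  have hck := Matrix.eigenvalue_pow_eq_one he hUe hUk
  have hdl := Matrix.eigenvalue_pow_eq_one hf hVf hVl
  have hc0 : c ≠ 0 := by rintro rfl; simp [hk.ne'] at hck
  have hd0 : d ≠ 0 := by rintro rfl; simp [hl.ne'] at hdl
  have hc : IsIntegral ℤ c := IsIntegral.of_pow hk (hck ▸ isIntegral_one)
  have hd : IsIntegral ℤ d := IsIntegral.of_pow hl (hdl ▸ isIntegral_one)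
  have hc' : IsIntegral ℤ c⁻¹ := IsIntegral.of_pow hk (by rw [inv_pow, hck, inv_one]; exact isIntegral_one)
  have hd' : IsIntegral ℤ d⁻¹ := IsIntegral.of_pow hl (by rw [inv_pow, hdl, inv_one]; exact isIntegral_one)
  -- the upper right entry of `U` in the basis `e, f`
  have hdet : (!![e 0, f 0; e 1, f 1]).det ≠ 0 := by
    intro h0
    obtain ⟨r, rfl⟩ := exists_eq_smul_of_det_eq_zero he h0
    have hr : r ≠ 0 := by rintro rfl; simp at hf
    refine hno (r • e) c d hf ?_ hVf
    rw [Matrix.mulVec_smul, hUe, smul_comm]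
  rw [Matrix.det_fin_two_of] at hdet
  have hUe' := Matrix.mulVec_eq_smul_iff_fin_two.mp hUe
  have hVf' := Matrix.mulVec_eq_smul_iff_fin_two.mp hVf
  rw [Matrix.det_fin_two] at hU hV
  -- This says `U f = s e + c⁻¹ f`: Cramer's rule gives the coordinates, and `det U = 1` makes the
  -- second one `c⁻¹`.
  obtain ⟨s, hs0, hs1⟩ : ∃ s : ℂ, U 0 0 * f 0 + U 0 1 * f 1 = s * e 0 + c⁻¹ * f 0 ∧
      U 1 0 * f 0 + U 1 1 * f 1 = s * e 1 + c⁻¹ * f 1 := by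
    have h1 : c⁻¹ * (e 0 * f 1 - f 0 * e 1)
        = e 0 * (U 1 0 * f 0 + U 1 1 * f 1) - e 1 * (U 0 0 * f 0 + U 0 1 * f 1) := by
      rw [inv_mul_eq_iff_eq_mul₀ hc0]
      linear_combination (U 1 0 * f 0 + U 1 1 * f 1) * hUe'.1
        - (U 0 0 * f 0 + U 0 1 * f 1) * hUe'.2 - (e 0 * f 1 - f 0 * e 1) * hU
    obtain ⟨s, h2⟩ : ∃ s : ℂ, s * (e 0 * f 1 - f 0 * e 1)
        = (U 0 0 * f 0 + U 0 1 * f 1) * f 1 - f 0 * (U 1 0 * f 0 + U 1 1 * f 1) :=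
      ⟨_, div_mul_cancel₀ _ hdet⟩
    refine ⟨s, mul_right_cancel₀ hdet ?_, mul_right_cancel₀ hdet ?_⟩
    · linear_combination -f 0 * h1 - e 0 * h2
    · linear_combination -f 1 * h1 - e 1 * h2
  obtain ⟨r, hr0, hr1⟩ : ∃ r : ℂ, V 0 0 * e 0 + V 0 1 * e 1 = d⁻¹ * e 0 + r * f 0 ∧
      V 1 0 * e 0 + V 1 1 * e 1 = d⁻¹ * e 1 + r * f 1 := by
    have h1 : d⁻¹ * (e 0 * f 1 - f 0 * e 1)
        = (V 0 0 * e 0 + V 0 1 * e 1) * f 1 - f 0 * (V 1 0 * e 0 + V 1 1 * e 1) := by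
      rw [inv_mul_eq_iff_eq_mul₀ hd0]
      linear_combination (V 0 0 * e 0 + V 0 1 * e 1) * hVf'.2
        - (V 1 0 * e 0 + V 1 1 * e 1) * hVf'.1 - (e 0 * f 1 - f 0 * e 1) * hV
    obtain ⟨r, h2⟩ : ∃ r : ℂ, r * (e 0 * f 1 - f 0 * e 1)
        = e 0 * (V 1 0 * e 0 + V 1 1 * e 1) - e 1 * (V 0 0 * e 0 + V 0 1 * e 1) :=
      ⟨_, div_mul_cancel₀ _ hdet⟩
    refine ⟨r, mul_right_cancel₀ hdet ?_, mul_right_cancel₀ hdet ?_⟩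
    · linear_combination -e 0 * h1 - f 0 * h2
    · linear_combination -e 1 * h1 - f 1 * h2
  -- Otherwise `f` would be a common eigenvector. Replacing `e` by `s e` then normalizes the upper
  -- right entry of `U` to `1`.
  have hs : s ≠ 0 := by
    rintro rfl
    refine hno f c⁻¹ d hf (Matrix.mulVec_eq_smul_iff_fin_two.mpr ⟨?_, ?_⟩) hVf
    · linear_combination hs0
    · linear_combination hs1
  have hdet' : (!![s * e 0, f 0; s * e 1, f 1]).det ≠ 0 := by
    rw [Matrix.det_fin_two_of]
    have := mul_ne_zero hs hdet
    rwa [mul_sub, ← mul_assoc, mul_left_comm s] at this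
  have hUB : U * !![s * e 0, f 0; s * e 1, f 1]
      = !![s * e 0, f 0; s * e 1, f 1] * !![c, 1; 0, c⁻¹] := by
    ext i j
    fin_cases i <;> fin_cases j <;> simp [Matrix.mul_apply, Fin.sum_univ_two]
    · linear_combination s * hUe'.1
    · linear_combination hs0
    · linear_combination s * hUe'.2
    · linear_combination hs1
  have hVB : V * !![s * e 0, f 0; s * e 1, f 1]
      = !![s * e 0, f 0; s * e 1, f 1] * !![d⁻¹, 0; s * r, d] := by
    ext i j
    fin_cases i <;> fin_cases j <;> simp [Matrix.mul_apply, Fin.sum_univ_two]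
    · linear_combination s * hr0
    · linear_combination hVf'.1
    · linear_combination s * hr1
    · linear_combination hVf'.2
  obtain ⟨B, hB⟩ : ∃ B : GL (Fin 2) ℂ,
      (B : Matrix (Fin 2) (Fin 2) ℂ) = !![s * e 0, f 0; s * e 1, f 1] :=
    ⟨Matrix.GeneralLinearGroup.mkOfDetNeZero _ hdet', rfl⟩
  rw [← hB] at hUB hVB
  -- The trace of the product in normal form is `c d⁻¹ + s r + c⁻¹ d`, so trace `2` determines the
  -- only entry not yet known to be integral.
  have hsr : s * r = 2 - c * d⁻¹ - c⁻¹ * d := by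
    have h1 : U * V = B * (!![c, 1; 0, c⁻¹] * !![d⁻¹, 0; s * r, d]) *
        ((B⁻¹ : GL (Fin 2) ℂ) : Matrix (Fin 2) (Fin 2) ℂ) := by
      rw [← mul_assoc, ← hUB, mul_assoc U, ← hVB, mul_assoc, mul_assoc, ← Units.val_mul,
        mul_inv_cancel, Units.val_one, mul_one]
    rw [h1, Matrix.trace_units_conj, Matrix.trace_fin_two] at htr
    simp [Matrix.mul_apply, Fin.sum_univ_two] at htr
    linear_combination htr
  refine ⟨B, _, _, hUB, hVB, ?_⟩
  have hint : IsIntegral ℤ (s * r) := by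
    have h2 : IsIntegral ℤ (2 : ℂ) := by simpa using isIntegral_algebraMap (R := ℤ) (A := ℂ) (x := 2)
    rw [hsr]
    exact (h2.sub (hc.mul hd')).sub (hc'.mul hd)
  intro i j
  fin_cases i <;> fin_cases j <;>
    simp [hc, hd, hc', hd', hint, isIntegral_zero, isIntegral_one]

/-- A nontrivial unipotent matrix is conjugate to `!![1, 1; 0, 1]`. -/
theorem exists_unipotent_form {u : Matrix (Fin 2) (Fin 2) ℂ} (hdet : u.det = 1)
    (htr : u.trace = 2) :
    ∃ (B : GL (Fin 2) ℂ) (M : Matrix (Fin 2) (Fin 2) ℂ),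
      u * (B : Matrix (Fin 2) (Fin 2) ℂ) = B * M ∧ ∀ i j, IsIntegral ℤ (M i j) := by
  by_cases hu : u = 1
  · refine ⟨1, 1, by simp [hu], fun i j => ?_⟩
    fin_cases i <;> fin_cases j <;> simp [isIntegral_zero, isIntegral_one]
  -- The basis is `n = (u - 1) v` and `v`: the first is fixed by `u`, and if the two were dependent
  -- `v` would be fixed as well.
  obtain ⟨v, hv⟩ : ∃ v : Fin 2 → ℂ, (u - 1).mulVec v ≠ 0 := by
    by_contra! h
    exact hu (sub_eq_zero.mp (Matrix.ext_of_mulVec_single fun i => by rw [h, Matrix.zero_mulVec]))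
  have hsq : (u - 1) * (u - 1) = 0 := Matrix.sub_one_mul_sub_one hdet htr
  obtain ⟨n, hn⟩ : ∃ n, (u - 1).mulVec v = n := ⟨_, rfl⟩
  have hun : u.mulVec n = n := by
    have : (u - 1).mulVec n = 0 := by rw [← hn, Matrix.mulVec_mulVec, hsq, Matrix.zero_mulVec]
    rwa [Matrix.sub_mulVec, Matrix.one_mulVec, sub_eq_zero] at this
  have huv : u.mulVec v = n + v := by
    rw [← hn, Matrix.sub_mulVec, Matrix.one_mulVec, sub_add_cancel]
  rw [hn] at hv
  have hB : (!![n 0, v 0; n 1, v 1]).det ≠ 0 := by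
    intro h0
    obtain ⟨c, rfl⟩ := exists_eq_smul_of_det_eq_zero hv h0
    rw [Matrix.mulVec_smul, hun] at huv
    exact hv (by simpa using huv)
  refine ⟨Matrix.GeneralLinearGroup.mkOfDetNeZero _ hB, !![1, 1; 0, 1], ?_, fun i j => ?_⟩
  · change u * !![n 0, v 0; n 1, v 1] = !![n 0, v 0; n 1, v 1] * _
    have h0 := congrFun hun
    have h1 := congrFun huv
    simp only [Matrix.mulVec, dotProduct, Fin.sum_univ_two, Pi.add_apply] at h0 h1
    ext i j
    fin_cases i <;> fin_cases j <;> simp [Matrix.mul_apply, Fin.sum_univ_two, h0, h1]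
  · fin_cases i <;> fin_cases j <;> simp [isIntegral_zero, isIntegral_one]

end TwoByTwo

/-! ### Descent of representations to subrings of finite rank -/

theorem Matrix.trace_adjugate_fin_two {R : Type*} [CommRing R] (M : Matrix (Fin 2) (Fin 2) R) :
    M.adjugate.trace = M.trace := by
  simp [Matrix.adjugate_fin_two, Matrix.trace_fin_two, add_comm]

/-- Adjoining finitely many integral elements gives a finite `ℤ`-module; inside `ℂ` it is
torsion-free, hence free. -/
theorem exists_subalgebra_basis_of_isIntegral {s : Set ℂ} (hs : s.Finite)
    (hint : ∀ w ∈ s, IsIntegral ℤ w) :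
    ∃ (A : Subalgebra ℤ ℂ) (m : ℕ) (_ : Module.Basis (Fin m) ℤ A), s ⊆ A := by
  have : Module.Finite ℤ (Algebra.adjoin ℤ s) :=
    Module.Finite.iff_fg.mpr (fg_adjoin_of_finite hs hint)
  have : Module.Free ℤ (Algebra.adjoin ℤ s) := inferInstance
  exact ⟨Algebra.adjoin ℤ s, _, Module.finBasis ℤ _, Algebra.subset_adjoin⟩

/-- A representation in `SL₂(ℂ)` is conjugate to one over `A` if a single base change conjugates a
set of generators into `SL₂(A)`. -/
theorem exists_isConjugateOver_of_generators {G : Type} [Group G] (γ : G →* SL(2, ℂ))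
    (A : Subalgebra ℤ ℂ) (B : GL (Fin 2) ℂ) {s : Set G} (hs : Subgroup.closure s = ⊤)
    (h : ∀ g ∈ s, ∃ N : Matrix (Fin 2) (Fin 2) A,
      (γ g : Matrix (Fin 2) (Fin 2) ℂ) * (B : Matrix (Fin 2) (Fin 2) ℂ) = B * N.map A.val) :
    ∃ γ' : G →* SL(2, A), IsConjugateOver γ A γ' := by
  have hinv : ((B⁻¹ : GL (Fin 2) ℂ) : Matrix (Fin 2) (Fin 2) ℂ) * (B : Matrix (Fin 2) (Fin 2) ℂ) = 1 := by
    rw [← Units.val_mul, inv_mul_cancel, Units.val_one]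
  have hinv' : (B : Matrix (Fin 2) (Fin 2) ℂ) * ((B⁻¹ : GL (Fin 2) ℂ) : Matrix (Fin 2) (Fin 2) ℂ) = 1 := by
    rw [← Units.val_mul, mul_inv_cancel, Units.val_one]
  let f : SL(2, A) →* GL (Fin 2) ℂ := Matrix.SpecialLinearGroup.toGL.comp
    (Matrix.SpecialLinearGroup.map (A.val : A →+* ℂ))
  have hfval (N : SL(2, A)) : (f N : Matrix (Fin 2) (Fin 2) ℂ)
      = (N : Matrix (Fin 2) (Fin 2) A).map A.val := rfl
  have hf : Function.Injective f := by
    intro N N' hN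
    have h1 := congrArg (fun g : GL (Fin 2) ℂ => (g : Matrix (Fin 2) (Fin 2) ℂ)) hN
    simp only [hfval] at h1
    exact Subtype.ext (Matrix.map_injective Subtype.val_injective h1)
  let δ : G →* GL (Fin 2) ℂ :=
    (MulAut.conj B⁻¹).toMonoidHom.comp (Matrix.SpecialLinearGroup.toGL.comp γ)
  have hδval (g : G) : (δ g : Matrix (Fin 2) (Fin 2) ℂ)
      = ((B⁻¹ : GL (Fin 2) ℂ) : Matrix (Fin 2) (Fin 2) ℂ) * (γ g : Matrix (Fin 2) (Fin 2) ℂ) * B := by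
    simp [δ]
  -- Only generators need checking, since `f` embeds `SL(2, A)` as a subgroup of `GL (Fin 2) ℂ`; the
  -- representation over `A` is then `δ` followed by the inverse of `f`.
  have hmem (g : G) : δ g ∈ f.range := by
    have : Subgroup.closure s ≤ f.range.comap δ := by
      rw [Subgroup.closure_le]
      intro g hg
      obtain ⟨N, hN⟩ := h g hg
      have hδN : (δ g : Matrix (Fin 2) (Fin 2) ℂ) = N.map A.val := by
        rw [hδval, mul_assoc, hN, ← mul_assoc, hinv, one_mul]
      have hdet : N.det = 1 := by
        apply Subtype.val_injective
        have h1 : A.val N.det = (N.map A.val).det := RingHom.map_det (A.val : A →+* ℂ) N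
        have h2 := congrArg Matrix.det hN
        rw [Matrix.det_mul, Matrix.det_mul, (γ g).det_coe, one_mul] at h2
        have h3 : (B : Matrix (Fin 2) (Fin 2) ℂ).det ≠ 0 :=
          ((Matrix.isUnit_iff_isUnit_det _).mp B.isUnit).ne_zero
        change A.val N.det = 1
        rw [h1]
        exact (mul_eq_left₀ h3).mp h2.symm
      exact ⟨⟨N, hdet⟩, Units.ext ((hfval _).trans hδN.symm)⟩
    have hg : g ∈ f.range.comap δ := this (hs ▸ Subgroup.mem_top g)
    exact hg
  refine ⟨(MonoidHom.ofInjective hf).symm.toMonoidHom.comp (δ.codRestrict f.range hmem), B,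
    fun g => ?_⟩
  have h1 : f ((MonoidHom.ofInjective hf).symm ⟨δ g, hmem g⟩) = δ g :=
    MonoidHom.apply_ofInjective_symm hf _
  have h2 := congrArg (fun g : GL (Fin 2) ℂ => (g : Matrix (Fin 2) (Fin 2) ℂ)) h1
  simp only [hfval, hδval] at h2
  change _ = _ * (((MonoidHom.ofInjective hf).symm ⟨δ g, hmem g⟩ : SL(2, A)) :
    Matrix (Fin 2) (Fin 2) A).map A.val * _
  rw [h2, mul_assoc, mul_assoc, hinv', mul_one, ← mul_assoc, hinv', one_mul]

theorem exists_isConjugateOver_of_isIntegral {G : Type} [Group G] (γ : G →* SL(2, ℂ))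
    (B : GL (Fin 2) ℂ) {s : Set G} (hsf : s.Finite) (hs : Subgroup.closure s = ⊤)
    (h : ∀ g ∈ s, ∃ M : Matrix (Fin 2) (Fin 2) ℂ,
      (γ g : Matrix (Fin 2) (Fin 2) ℂ) * (B : Matrix (Fin 2) (Fin 2) ℂ) = B * M ∧
        ∀ i j, IsIntegral ℤ (M i j)) :
    ∃ (A : Subalgebra ℤ ℂ) (m : ℕ) (_ : Module.Basis (Fin m) ℤ A) (γ' : G →* SL(2, A)),
      IsConjugateOver γ A γ' := by
  choose! M hM hint using h
  have hfin : (⋃ g ∈ s, Set.range fun k : Fin 2 × Fin 2 => M g k.1 k.2).Finite :=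
    hsf.biUnion fun g _ => Set.finite_range _
  obtain ⟨A, m, β, hA⟩ := exists_subalgebra_basis_of_isIntegral hfin (by
    intro w hw
    simp only [Set.mem_iUnion] at hw
    obtain ⟨g, hg, ⟨k, rfl⟩⟩ := hw
    exact hint g hg _ _)
  have hmem (g : G) (hg : g ∈ s) (i j : Fin 2) : M g i j ∈ A :=
    hA (Set.mem_biUnion hg ⟨(i, j), rfl⟩)
  obtain ⟨γ', hγ'⟩ := exists_isConjugateOver_of_generators γ A B hs fun g hg =>
    ⟨Matrix.of fun i j => ⟨M g i j, hmem g hg i j⟩, by rw [hM g hg]; rfl⟩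
  exact ⟨A, m, β, γ', hγ'⟩

/-- An eigenvector of a set of generators is an eigenvector of the whole group. -/
theorem forall_exists_mulVec_eq_smul {G : Type*} [Group G] (γ : G →* SL(2, ℂ)) {s : Set G}
    (hs : Subgroup.closure s = ⊤) {w : Fin 2 → ℂ} (hw : w ≠ 0)
    (h : ∀ g ∈ s, ∃ c : ℂ, (γ g : Matrix (Fin 2) (Fin 2) ℂ).mulVec w = c • w) (g : G) :
    ∃ c : ℂ, (γ g : Matrix (Fin 2) (Fin 2) ℂ).mulVec w = c • w := by
  have hg : g ∈ Subgroup.closure s := hs ▸ Subgroup.mem_top g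
  induction hg using Subgroup.closure_induction with
  | mem g hg => exact h g hg
  | one => exact ⟨1, by simp⟩
  | mul g g' _ _ ih ih' =>
    obtain ⟨c, hc⟩ := ih
    obtain ⟨c', hc'⟩ := ih'
    refine ⟨c' * c, ?_⟩
    rw [map_mul, Matrix.SpecialLinearGroup.coe_mul, ← Matrix.mulVec_mulVec, hc', Matrix.mulVec_smul,
      hc, smul_smul]
  | inv g _ ih =>
    obtain ⟨c, hc⟩ := ih
    have h1 : (γ g⁻¹ : Matrix (Fin 2) (Fin 2) ℂ) * (γ g : Matrix (Fin 2) (Fin 2) ℂ) = 1 := by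
      rw [← Matrix.SpecialLinearGroup.coe_mul, ← map_mul, inv_mul_cancel, map_one,
        Matrix.SpecialLinearGroup.coe_one]
    have h2 := congrArg (Matrix.mulVec (γ g⁻¹ : Matrix (Fin 2) (Fin 2) ℂ)) hc
    rw [Matrix.mulVec_mulVec, h1, Matrix.one_mulVec, Matrix.mulVec_smul] at h2
    have hc0 : c ≠ 0 := by
      rintro rfl
      rw [zero_smul] at h2
      exact hw h2
    exact ⟨c⁻¹, by rw [eq_inv_smul_iff₀ hc0, ← h2]⟩

/-! ### Parabolic representations of torus knot groups -/

section TorusRepresentation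

variable {G : Type} [Group G] {p q a b : ℕ} {P Q : G}

/-- The element `P ^ q = Q ^ p` commutes with both generators, so its image is scalar unless `γ P`
and `γ Q` commute; determinant `1` gives `s ^ 2 = 1`. The sign `s = -1` is why the square of `P ^ q`
is used later. -/
theorem commute_or_central_eq_smul (h : Subgroup.closure {P, Q} = ⊤) (hPQ : P ^ q = Q ^ p)
    (γ : G →* SL(2, ℂ)) :
    (∀ g g', Commute (γ g) (γ g')) ∨
      ∃ s : ℂ, s ^ 2 = 1 ∧ (γ (P ^ q) : Matrix (Fin 2) (Fin 2) ℂ) = s • 1 := by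
  by_cases hc : Commute (γ P) (γ Q)
  · left
    refine commute_map_map_of_closure_eq_top h γ ?_
    rintro g (rfl | rfl) g' (rfl | rfl)
    exacts [Commute.refl _, hc, hc.symm, Commute.refl _]
  · right
    have hval {x y : SL(2, ℂ)} (hxy : Commute x y) : (x : Matrix (Fin 2) (Fin 2) ℂ) * y = y * x :=
      congrArg Subtype.val hxy
    obtain ⟨s, hs⟩ := Matrix.exists_eq_smul_one_of_commute
      (hval (x := γ (P ^ q)) (y := γ P) (((Commute.refl P).pow_left q).map γ))
      (hval (x := γ (P ^ q)) (y := γ Q) ((hPQ ▸ (Commute.refl Q).pow_left p : Commute (P ^ q) Q).map γ))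
      (fun h => hc (Subtype.ext h))
    refine ⟨s, ?_, hs⟩
    have := (γ (P ^ q)).det_coe
    rw [hs, Matrix.det_smul] at this
    simpa using this

variable {ι : Type} {x : ι → G} {o : ι}

theorem map_eq_of_commute (hconj : ∀ c, ∃ g, x c = g * x o * g⁻¹) {γ : G →* SL(2, ℂ)}
    (hcomm : ∀ g g', Commute (γ g) (γ g')) (c : ι) : γ (x c) = γ (x o) := by
  obtain ⟨g, hg⟩ := hconj c
  rw [hg, map_mul, map_mul, (hcomm g (x o)).eq, map_inv, mul_inv_cancel_right]

/-- For a parabolic representation, the image of the central element `(P ^ q) ^ 2` is unipotent. -/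
theorem central_sub_one_mul_self (h : Subgroup.closure {P, Q} = ⊤) (hPQ : P ^ q = Q ^ p)
    (hx : Subgroup.closure (Set.range x) = ⊤) (hconj : ∀ c, ∃ g, x c = g * x o * g⁻¹)
    (γ : G →* SL(2, ℂ)) (htr : (γ (x o) : Matrix (Fin 2) (Fin 2) ℂ).trace = 2) :
    ((γ ((P ^ q) ^ 2) : Matrix (Fin 2) (Fin 2) ℂ) - 1) *
      ((γ ((P ^ q) ^ 2) : Matrix (Fin 2) (Fin 2) ℂ) - 1) = 0 := by
  rcases commute_or_central_eq_smul h hPQ γ with hcomm | ⟨s, hs, hsz⟩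
  · have hmem : ∀ g, γ g ∈ Subgroup.zpowers (γ (x o)) := by
      intro g
      have : Subgroup.closure (Set.range x) ≤ (Subgroup.zpowers (γ (x o))).comap γ := by
        rw [Subgroup.closure_le]
        rintro _ ⟨c, rfl⟩
        rw [SetLike.mem_coe, Subgroup.mem_comap, map_eq_of_commute hconj hcomm c]
        exact Subgroup.mem_zpowers (γ (x o))
      have hg : g ∈ (Subgroup.zpowers (γ (x o))).comap γ :=
        this (hx ▸ Subgroup.mem_top g)
      exact hg
    -- The geometric sum makes `u ^ n - 1` a multiple of `u - 1` on either side, so its square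
    -- contains the factor `(u - 1)²`.
    have key (u : SL(2, ℂ)) (hu : ((u : Matrix (Fin 2) (Fin 2) ℂ) - 1) *
        ((u : Matrix (Fin 2) (Fin 2) ℂ) - 1) = 0) (n : ℕ) :
        (((u ^ n : SL(2, ℂ)) : Matrix (Fin 2) (Fin 2) ℂ) - 1) *
          (((u ^ n : SL(2, ℂ)) : Matrix (Fin 2) (Fin 2) ℂ) - 1) = 0 := by
      rw [Matrix.SpecialLinearGroup.coe_pow]
      nth_rw 1 [← geom_sum_mul]
      rw [← mul_geom_sum, mul_assoc, ← mul_assoc (_ - 1) (_ - 1), hu, zero_mul, mul_zero]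
    obtain ⟨n, hn⟩ := hmem ((P ^ q) ^ 2)
    have hu := Matrix.sub_one_mul_sub_one (γ (x o)).det_coe htr
    obtain ⟨m, rfl | rfl⟩ := n.eq_nat_or_neg
    · rw [← hn]
      simpa using key _ hu m
    · rw [← hn]
      simp only [zpow_neg, zpow_natCast, ← inv_pow]
      refine key _ (Matrix.sub_one_mul_sub_one (γ (x o))⁻¹.det_coe ?_) m
      rw [Matrix.SpecialLinearGroup.coe_inv, Matrix.trace_adjugate_fin_two, htr]
  · have h1 : (γ ((P ^ q) ^ 2) : Matrix (Fin 2) (Fin 2) ℂ) = 1 := by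
      rw [map_pow, Matrix.SpecialLinearGroup.coe_pow, hsz, smul_pow, hs, one_pow, one_smul]
    rw [h1, sub_self, zero_mul]

/-- A parabolic representation of the group of a torus knot has a total representation. -/
theorem exists_isConjugateOver_of_parabolic [Finite ι] (hp : 0 < p) (hq : 0 < q) (hab : a * p = b * q + 1)
    (hPQ : P ^ q = Q ^ p) (hPa : P ^ a = x o * Q ^ b)
    (h : Subgroup.closure {P, Q} = ⊤)
    (hx : Subgroup.closure (Set.range x) = ⊤) (hconj : ∀ c, ∃ g, x c = g * x o * g⁻¹)
    (γ : G →* SL(2, ℂ)) (htr : ∀ c, (γ (x c) : Matrix (Fin 2) (Fin 2) ℂ).trace = 2) :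
    ∃ (A : Subalgebra ℤ ℂ) (m : ℕ) (_ : Module.Basis (Fin m) ℤ A) (γ' : G →* SL(2, A)),
      IsConjugateOver γ A γ' := by
  by_cases hcomm : ∀ g g', Commute (γ g) (γ g')
  · obtain ⟨B, M, hM, hint⟩ := exists_unipotent_form (γ (x o)).det_coe (htr o)
    refine exists_isConjugateOver_of_isIntegral γ B (Set.finite_range x) hx ?_
    rintro _ ⟨c, rfl⟩
    exact ⟨M, by rw [map_eq_of_commute hconj hcomm, hM], hint⟩
  obtain ⟨s, hs, hsz⟩ := (commute_or_central_eq_smul h hPQ γ).resolve_left hcomm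
  have hz2 : γ (P ^ q) ^ 2 = 1 := by
    apply Subtype.ext
    rw [Matrix.SpecialLinearGroup.coe_pow, hsz, smul_pow, hs, one_pow, one_smul,
      Matrix.SpecialLinearGroup.coe_one]
  have hgen := closure_triple_eq_top hab hPQ h
  have hsint : IsIntegral ℤ s := IsIntegral.of_pow two_pos (hs ▸ isIntegral_one)
  -- The power `(P ^ a) ^ (2 q)` is a power of `(P ^ q) ^ 2`, which `γ` kills.
  have hUk : (γ (P ^ a) : Matrix (Fin 2) (Fin 2) ℂ) ^ (q * 2) = 1 := by
    rw [← Matrix.SpecialLinearGroup.coe_pow, ← map_pow, ← pow_mul, mul_comm a, mul_assoc, pow_mul,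
      mul_comm 2, pow_mul', map_pow, map_pow, hz2, one_pow, Matrix.SpecialLinearGroup.coe_one]
  have hVl : (γ (Q ^ b)⁻¹ : Matrix (Fin 2) (Fin 2) ℂ) ^ (p * 2) = 1 := by
    rw [← Matrix.SpecialLinearGroup.coe_pow, ← map_pow, inv_pow, ← pow_mul, mul_comm b, mul_assoc,
      pow_mul, ← hPQ, mul_comm 2, pow_mul', map_inv, map_pow, map_pow, hz2, one_pow, inv_one,
      Matrix.SpecialLinearGroup.coe_one]
  have hUV : ((γ (P ^ a) : Matrix (Fin 2) (Fin 2) ℂ) * (γ (Q ^ b)⁻¹ : Matrix (Fin 2) (Fin 2) ℂ)).trace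
      = 2 := by
    rw [← Matrix.SpecialLinearGroup.coe_mul, ← map_mul, hPa, mul_inv_cancel_right, htr]
  obtain ⟨B, M, N, hM, hN, hint⟩ := exists_riley_form (γ (P ^ a)).det_coe (γ (Q ^ b)⁻¹).det_coe
    (Nat.mul_pos hq two_pos) (Nat.mul_pos hp two_pos) hUk hVl hUV (by
      -- As `P ^ q` acts by a scalar, a common eigenvector of `U` and `V` is one for the whole
      -- group. Each `x c` then fixes it, being parabolic, and parabolic matrices fixing the same
      -- vector commute, against the case assumption.
      intro w c d hw hUw hVw
      have hall := forall_exists_mulVec_eq_smul γ hgen hw (by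
        rintro g (hg | hg | hg)
        · exact ⟨c, by rw [hg, hUw]⟩
        · exact ⟨d, by rw [hg, hVw]⟩
        · exact ⟨s, by rw [hg, hsz, Matrix.smul_mulVec, Matrix.one_mulVec]⟩)
      have hone (c : ι) : (γ (x c) : Matrix (Fin 2) (Fin 2) ℂ).mulVec w = (1 : ℂ) • w := by
        obtain ⟨r, hr⟩ := hall (x c)
        rw [hr, Matrix.eigenvalue_eq_one_of_trace_eq_two (γ (x c)).det_coe (htr c) hw hr]
      refine hcomm (commute_map_map_of_closure_eq_top hx γ ?_)
      rintro _ ⟨c, rfl⟩ _ ⟨c', rfl⟩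
      exact Subtype.ext (Matrix.commute_of_mulVec_eq_self (htr c) (htr c') hw (hone c) (hone c')))
  refine exists_isConjugateOver_of_isIntegral γ B (by simp) hgen ?_
  rintro g (hg | hg | hg)
  · exact ⟨M, by rw [hg, hM], fun i j => (hint i j).1⟩
  · exact ⟨N, by rw [hg, hN], fun i j => (hint i j).2⟩
  · refine ⟨s • 1, by rw [hg, hsz]; simp, fun i j => ?_⟩
    fin_cases i <;> fin_cases j <;> simp [hsint, isIntegral_zero]

end TorusRepresentation

/-! ### Transfer to total representations, mirror images, and conclusion -/

theorem IsConjugateOver.sub_one_mul_self {G : Type} [Group G] {γ : G →* SL(2, ℂ)}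
    {A : Subalgebra ℤ ℂ} {γ' : G →* SL(2, A)} (h : IsConjugateOver γ A γ') {g : G}
    (hg : ((γ g : Matrix (Fin 2) (Fin 2) ℂ) - 1) * ((γ g : Matrix (Fin 2) (Fin 2) ℂ) - 1) = 0) :
    ((γ' g : Matrix (Fin 2) (Fin 2) A) - 1) * ((γ' g : Matrix (Fin 2) (Fin 2) A) - 1) = 0 := by
  obtain ⟨B, hB⟩ := h
  set N := (γ' g : Matrix (Fin 2) (Fin 2) A)
  apply Matrix.map_injective (f := A.val) Subtype.val_injective
  have hmap : ((N - 1) * (N - 1)).map A.val = (N.map A.val - 1) * (N.map A.val - 1) := by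
    have := map_mul (A.val : A →+* ℂ).mapMatrix (N - 1) (N - 1)
    rw [map_sub, map_one] at this
    exact this
  have hconj : (γ g : Matrix (Fin 2) (Fin 2) ℂ) - 1 = B * (N.map A.val - 1) *
      ((B⁻¹ : GL (Fin 2) ℂ) : Matrix (Fin 2) (Fin 2) ℂ) := by
    rw [hB g, mul_sub, sub_mul, mul_one, Units.mul_inv]
  have h1 : (B : Matrix (Fin 2) (Fin 2) ℂ) * ((N.map A.val - 1) * (N.map A.val - 1)) *
      ((B⁻¹ : GL (Fin 2) ℂ) : Matrix (Fin 2) (Fin 2) ℂ) = 0 := by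
    rw [← hg, hconj]
    simp only [mul_assoc, Units.inv_mul_cancel_left]
  rw [Units.mul_left_eq_zero, Units.mul_right_eq_zero] at h1
  change ((N - 1) * (N - 1)).map A.val = (0 : Matrix (Fin 2) (Fin 2) A).map A.val
  rw [hmap, h1, Matrix.map_zero _ (map_zero _)]

theorem totalRepresentation_sub_one_mul_self {G : Type} [Group G] {A : Type} [CommRing A] {m : ℕ}
    (β : Module.Basis (Fin m) ℤ A) (γ' : G →* SL(2, A)) {g : G}
    (hg : ((γ' g : Matrix (Fin 2) (Fin 2) A) - 1) * ((γ' g : Matrix (Fin 2) (Fin 2) A) - 1) = 0) :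
    ((totalRepresentation β γ' g : Matrix (Fin 2 × Fin m) (Fin 2 × Fin m) ℤ) - 1) *
      ((totalRepresentation β γ' g : Matrix (Fin 2 × Fin m) (Fin 2 × Fin m) ℤ) - 1) = 0 := by
  have h1 : (totalRepresentation β γ' g : Matrix (Fin 2 × Fin m) (Fin 2 × Fin m) ℤ)
      = blockHom β (γ' g : Matrix (Fin 2) (Fin 2) A) := rfl
  rw [h1, ← map_one (blockHom β), ← map_sub, ← map_mul, hg, map_zero]

/-- The generators of the torus knot group, or their inverses for the mirror image, satisfy the
Wirtinger relations of the torus knot. -/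
theorem WirtingerData.exists_torus_relations {p q : ℕ}
    (W : WirtingerData (ZMod q × ZMod p) (ZMod q × ZMod p))
    (hW : W = torusKnot p q ∨ W = (torusKnot p q).mirror) :
    ∃ x : ZMod q × ZMod p → W.KnotGroup,
      (∀ c : ZMod q × ZMod p, x (c.1, 0) * x c = x (c.1 + 1, c.2 - 1) * x (c.1, 0)) ∧
      Subgroup.closure (Set.range x) = ⊤ ∧
      (∃ t : Multiplicative ℤ, t.toAdd ≠ 0 ∧ ∀ c, W.epsilon (x c) = t) ∧
      ∀ γ : W.KnotGroup →* SL(2, ℂ), W.IsParabolic γ →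
        ∀ c, (γ (x c) : Matrix (Fin 2) (Fin 2) ℂ).trace = 2 := by
  have heps (c : ZMod q × ZMod p) : W.epsilon (W.gen c) = Multiplicative.ofAdd 1 :=
    PresentedGroup.toGroup.of _
  have htr (γ : W.KnotGroup →* SL(2, ℂ)) (hγ : W.IsParabolic γ) (c : ZMod q × ZMod p) :
      (γ (W.gen c) : Matrix (Fin 2) (Fin 2) ℂ).trace = 2 := hγ _ ⟨c, 1, by simp⟩
  rcases hW with rfl | rfl
  · exact ⟨_, (torusKnot p q).gen_relation, closure_range_gen _, ⟨_, by simp, heps⟩, htr⟩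
  -- Inverting both sides of a mirror relation gives the torus relation for the inverse generators.
  -- In `SL₂` inversion preserves the trace, and `ε` becomes `-1`, still nonzero.
  · refine ⟨fun c => ((torusKnot p q).mirror.gen c)⁻¹, fun c => ?_, ?_,
      ⟨Multiplicative.ofAdd (-1), by simp, fun c => ?_⟩, fun γ hγ c => ?_⟩
    · have h : (torusKnot p q).mirror.gen (c.1, 0) * (torusKnot p q).mirror.gen (c.1 + 1, c.2 - 1)
          = (torusKnot p q).mirror.gen c * (torusKnot p q).mirror.gen (c.1, 0) :=
        (torusKnot p q).mirror.gen_relation c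
      simpa only [mul_inv_rev] using (congrArg (·⁻¹) h).symm
    · rw [← Set.inv_range, Subgroup.closure_inv, closure_range_gen]
    · rw [map_inv, heps]; rfl
    · rw [map_inv, Matrix.SpecialLinearGroup.coe_inv, Matrix.trace_adjugate_fin_two, htr γ hγ]

theorem theorem7p1 (p q : ℕ) (hp : 0 < p) (hq : 0 < q) (hpq : Nat.Coprime p q)
    (W : WirtingerData (ZMod q × ZMod p) (ZMod q × ZMod p))
    (hW : W = torusKnot p q ∨ W = (torusKnot p q).mirror)
    (γ : W.KnotGroup →* Matrix.SpecialLinearGroup (Fin 2) ℂ) (hγ : W.IsParabolic γ) :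
    -- `γ` has a total representation
    (∃ (A : Subalgebra ℤ ℂ) (m : ℕ) (_ : Module.Basis (Fin m) ℤ A)
      (γ' : W.KnotGroup →* Matrix.SpecialLinearGroup (Fin 2) A), IsConjugateOver γ A γ') ∧
    -- every total twisted Alexander polynomial of `γ` is a product of cyclotomic polynomials
    (∀ (A : Subalgebra ℤ ℂ) (m : ℕ) (β : Module.Basis (Fin m) ℤ A)
      (γ' : W.KnotGroup →* Matrix.SpecialLinearGroup (Fin 2) A), IsConjugateOver γ A γ' →
      (∃ Δ, W.IsTwistedAlexanderPolynomial (totalRepresentation β γ') Δ) ∧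
      ∀ Δ, W.IsTwistedAlexanderPolynomial (totalRepresentation β γ') Δ →
        IsProductOfCyclotomics Δ) ∧
    -- the zeros of the `γ`-twisted Alexander polynomial are roots of unity
    (∃ Δ, W.IsTwistedAlexanderPolynomial (Matrix.SpecialLinearGroup.toGL.comp γ) Δ) ∧
    ∀ Δ, W.IsTwistedAlexanderPolynomial (Matrix.SpecialLinearGroup.toGL.comp γ) Δ →
      IsProductOfRootOfUnityFactors Δ := by
  have : NeZero p := ⟨hp.ne'⟩
  have : NeZero q := ⟨hq.ne'⟩
  obtain ⟨x, hx, hgen, ⟨t, ht, heps⟩, htr⟩ := W.exists_torus_relations hW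
  obtain ⟨P, Q, a, b, hab, hPQ, hPa, hconj, hP⟩ := exists_torus_generators x hx hp hq hpq
  have hclosure : Subgroup.closure {P, Q} = ⊤ := by
    rw [eq_top_iff, ← hgen, Subgroup.closure_le]
    rintro _ ⟨c, rfl⟩
    obtain ⟨g, hg, hc⟩ := hconj c
    have h0 : x (0, 0) ∈ Subgroup.closure {P, Q} := by
      rw [← mul_inv_eq_iff_eq_mul.mpr hPa]
      exact Subgroup.mul_mem _ (Subgroup.pow_mem _ (Subgroup.subset_closure (by simp)) a)
        (Subgroup.inv_mem _ (Subgroup.pow_mem _ (Subgroup.subset_closure (by simp)) b))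
    rw [hc]
    exact Subgroup.mul_mem _ (Subgroup.mul_mem _ hg h0) (Subgroup.inv_mem _ hg)
  have hconj' (c : ZMod q × ZMod p) : ∃ g, x c = g * x (0, 0) * g⁻¹ :=
    (hconj c).imp fun _ h => h.2
  have hcentral (g : W.KnotGroup) : (P ^ q) ^ 2 * g = g * (P ^ q) ^ 2 := by
    refine ((commute_map_of_closure_eq_top hclosure (MonoidHom.id _) (y := P ^ q) ?_ g).pow_left 2).eq
    rintro g (rfl | hg)
    · exact (Commute.refl g).pow_left q
    · rw [hg, hPQ]
      exact (Commute.refl Q).pow_left p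
  -- The exponent is `2 p q` times that of `t`; if it vanished, the annihilator `(t ^ ε(z) - 1)²`
  -- would be zero and carry no information.
  have hexp : (W.epsilon ((P ^ q) ^ 2)).toAdd ≠ 0 := by
    have h1 : W.epsilon ((P ^ q) ^ 2) = ((t ^ p) ^ q) ^ 2 := by
      rw [map_pow, map_pow, hP _ t heps]
    rw [h1, toAdd_pow, toAdd_pow, toAdd_pow]
    simp [hp.ne', hq.ne', ht]
  have huni := central_sub_one_mul_self hclosure hPQ hgen hconj' γ (htr γ hγ _)
  refine ⟨exists_isConjugateOver_of_parabolic hp hq hab hPQ hPa hclosure hgen hconj' γ (htr γ hγ),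
    fun A m β γ' hγ' => ⟨exists_isModuleOrder _, fun Δ hΔ => ?_⟩, exists_isModuleOrder _,
    fun Δ hΔ => ?_⟩
  · obtain ⟨k, hk⟩ := IsModuleOrder.dvd_pow hΔ (W.smul_twistedH1_eq_zero _ hcentral
      (totalRepresentation_sub_one_mul_self β γ' (hγ'.sub_one_mul_self huni)))
    rw [← pow_mul] at hk
    exact isProductOfCyclotomics_of_dvd hexp _ hk
  · obtain ⟨k, hk⟩ := IsModuleOrder.dvd_pow hΔ
      (W.smul_twistedH1_eq_zero (Matrix.SpecialLinearGroup.toGL.comp γ) hcentral huni)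
    rw [← pow_mul] at hk
    exact isProductOfRootOfUnityFactors_of_dvd hexp _ hk
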